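/- **Setting.** Let $(M,g)$ be a complete smooth Riemannian manifold of dimension $n\ge 1$ and $\gamma:\mathbb R\to M$ a geodesic parametrized by arc length. Let $(e_1,\dots,e_n)$ be the frame along $\gamma$ obtained by parallel transport of an orthonormal basis of $T_{\gamma(0)}M$ with $e_1(0)=\dot\gamma(0)$, and let $$\exp^\perp(x^1,\vec x)=\exp_{\gamma(x^1)}\Big(\sum_{m=2}^n x^m e_m(x^1)\Big),\qquad \vec x=(x^2,\dots,x^n)\in\mathbb R^{n-1}.$$ Let $r_{\rm foc}\in[0,\infty]$ be the focal radius of $\gamma$, the largest radius such that $\exp^\perp$ has no critical point (is a local diffeomorphism) on $\{|\vec x|<r_{\rm foc}\}$, and put $\mathcal N=\{|\vec x|<r_{\rm foc}\}$. Equip $\mathbb R\times\mathcal N$ with the pull-back metric $(\exp^\perp)^*g$; let $\Gamma^i_{jk}$ be its Christoffel symbols and $R_{abcl}=\langle R(\partial_a,\partial_b)\partial_c,\partial_l\rangle$, $R(X,Y)=\nabla_X\nabla_Y-\nabla_Y\nabla_X-\nabla_{[X,Y]}$, its curvature components (geodesic normal, or Fermi, coordinates). On $\mathbb R^{1+d}$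 let $\mathfrak m=\mathrm{diag}(-1,1,\dots,1)$ and $\Box=\mathfrak m^{\mu\nu}\partial_\mu\partial_\nu$; let $\ell:\mathbb R^{1+d}\to\mathbb R$ be linear and $\sigma=\mathfrak m(d\ell,d\ell)$. For a tuple $A=(A_1,\dots,A_q)$ in $\{1,\dots,n\}$ write $|A|=q$, $\partial_A=\partial_{A_1}\cdots\partial_{A_q}$, $\boldsymbol u^A=u^{A_1}\cdots u^{A_q}$. Repeated indices $j,k$ are summed over $1,\dots,n$. **Proposition.** (a) If $r_{\rm foc}>0$, then for all $q\ge 0$, all $i,j,k$ and all $s\in\mathbb R$, $\partial_1^q\Gamma^i_{jk}(s,\vec 0)=0$. (b) There are functions $h^i(s,\boldsymbol u,p)$, $1\le i\le n$, smooth on $\{s\in\mathbb R,\ \boldsymbol u\in\mathbb R\times\mathcal N,\ p\in\mathbb R^{n(d+1)}\}$, with the following property. Let $\boldsymbol u=(u^1,\vec u)$ be an $\mathbb R^n$-valued map on $\mathbb R^{1+d}$, of class $C^2$ near a point, with value in $\mathbb R\times\mathcal N$ at that point. Then at that point the wave map equations $$\Box\phi^i+\Gamma^i_{jk}(\phi)\,\mathfrak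 m(d\phi^j,d\phi^k)=0,\qquad \phi=(\ell+u^1,\vec u),$$ are equivalent, component by component, to the wave equation ($i=1$) $$\begin{aligned}\Box u^1=&-2\sum_{m=2}^nR_{m1j1}(\ell,\vec0)\,u^m\,\mathfrak m(du^j,d\ell)-\sum_{|A|=2,\,A\ne(1,1)}\tfrac1{2!}\partial_A\Gamma^1_{11}(\ell,\vec0)\,\boldsymbol u^A\sigma\\&-\sum_{m=2}^n\partial_m\Gamma^1_{jk}(\ell,\vec0)\,u^m\,\mathfrak m(du^j,du^k)-2\sum_{|A|=2,\,A\ne(1,1)}\tfrac1{2!}\partial_A\Gamma^1_{j1}(\ell,\vec0)\,\boldsymbol u^A\,\mathfrak m(du^j,d\ell)\\&-\sum_{|A|=3,\,A\ne(1,1,1)}\tfrac1{3!}\partial_A\Gamma^1_{11}(\ell,\vec0)\,\boldsymbol u^A\sigma+h^1(\ell,\boldsymbol u,\partial\boldsymbol u)\end{aligned}$$ and the Klein–Gordon type equations ($2\le i\le n$) $$\begin{aligned}\Box u^i+\sum_{m=2}^nR_{m11i}(\ell,\vec0)\,u^m\sigma=&-2\sum_{m=2}^nR_{m1ji}(\ell,\vec0)\,u^m\,\mathfrak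 m(du^j,d\ell)-\sum_{|A|=2,\,A\ne(1,1)}\tfrac1{2!}\partial_A\Gamma^i_{11}(\ell,\vec0)\,\boldsymbol u^A\sigma\\&-\sum_{m=2}^n\partial_m\Gamma^i_{jk}(\ell,\vec0)\,u^m\,\mathfrak m(du^j,du^k)-2\sum_{|A|=2,\,A\ne(1,1)}\tfrac1{2!}\partial_A\Gamma^i_{j1}(\ell,\vec0)\,\boldsymbol u^A\,\mathfrak m(du^j,d\ell)\\&-\sum_{|A|=3,\,A\ne(1,1,1)}\tfrac1{3!}\partial_A\Gamma^i_{11}(\ell,\vec0)\,\boldsymbol u^A\sigma+h^i(\ell,\boldsymbol u,\partial\boldsymbol u).\end{aligned}$$ (c) The $h^i$ are of higher order: there are a continuous function $C:\mathbb R\to\mathbb R$ and a function $f(\boldsymbol u,p)$, smooth on $(\mathbb R\times\mathcal N)\times\mathbb R^{n(d+1)}$, with $$|h^i(s,\boldsymbol u,p)|\le C(s)\,(|\boldsymbol u|^4+|p|^4)\,f(\boldsymbol u,p)$$ for all $i$ and all $(s,\boldsymbol u,p)$ in the domain. If for every $\rho<r_{\rm foc}$ the derivatives of the $\Gamma^i_{jk}$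 of orders $2,3,4$ are bounded on $\{|\vec x|\le\rho\}$, then $C$ can be taken constant. -/

import Mathlib

open scoped ContDiff Manifold

noncomputable section

namespace FermiWaveMap

/-- Coordinate space `ℝⁿ` with its Euclidean norm. -/
abbrev V (n : ℕ) : Type := EuclideanSpace ℝ (Fin n)

/-- The `i`-th coordinate vector of `ℝⁿ`. -/
def basisVec {n : ℕ} (i : Fin n) : V n := EuclideanSpace.single i (1 : ℝ)

/-- The partial derivative `∂ᵢ f` at `x`. -/
def pderiv {n : ℕ} (i : Fin n) (f : V n → ℝ) (x : V n) : ℝ := fderiv ℝ f x (basisVec i)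

/-- The iterated partial derivative `∂_A f = ∂_{A₁} ⋯ ∂_{A_q} f` at `x`, for a `q`-tuple `A`. -/
def multiDeriv {n q : ℕ} (A : Fin q → Fin n) (f : V n → ℝ) (x : V n) : ℝ :=
  iteratedFDeriv ℝ q f x (fun a => basisVec (A a))

/-! ### Christoffel symbols and curvature of a metric given by its coefficients -/

/-- The Christoffel symbol `Γⁱ_{jk}` of the metric with coefficient matrix `G` on a domain
of `ℝⁿ`. -/
def christoffel {n : ℕ} (G : V n → Matrix (Fin n) (Fin n) ℝ) (i j k : Fin n) (x : V n) : ℝ :=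
  (1 / 2) * ∑ l, (G x)⁻¹ i l *
    (pderiv j (fun z => G z k l) x + pderiv k (fun z => G z j l) x - pderiv l (fun z => G z j k) x)

/-- The curvature component `R_{abcl} = ⟨R(∂_a, ∂_b) ∂_c, ∂_l⟩`, with
`R(X, Y) = ∇_X ∇_Y - ∇_Y ∇_X - ∇_[X,Y]`. -/
def riemann {n : ℕ} (G : V n → Matrix (Fin n) (Fin n) ℝ) (a b c l : Fin n) (x : V n) : ℝ :=
  ∑ p, G x l p *
    (pderiv a (christoffel G p b c) x - pderiv b (christoffel G p a c) x
      + ∑ q, (christoffel G q b c x * christoffel G p a q x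
          - christoffel G q a c x * christoffel G p b q x))

/-! ### Geodesics, parallel fields and the exponential map of a Riemannian manifold -/

section Manifold

variable {n : ℕ} {M : Type*} [TopologicalSpace M] [ChartedSpace (V n) M] [IsManifold (𝓡 n) ∞ M]

/-- Smooth Riemannian metrics on the `n`-dimensional manifold `M`. -/
abbrev Metric (n : ℕ) (M : Type*) [TopologicalSpace M] [ChartedSpace (V n) M]
    [IsManifold (𝓡 n) ∞ M] :=
  Bundle.ContMDiffRiemannianMetric (𝓡 n) ∞ (V n) (fun x : M => TangentSpace (𝓡 n) x)

/-- The coefficient matrix `⟨dF(∂ᵢ), dF(∂ⱼ)⟩_g` of the pull-back of `g` along `F : ℝⁿ → M`. For `F`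
the inverse of a chart this is the metric in local coordinates. -/
def pullbackMetric (g : Metric n M) (F : V n → M) (x : V n) : Matrix (Fin n) (Fin n) ℝ :=
  fun i j => g.inner (F x) (mfderiv (𝓡 n) (𝓡 n) F x (basisVec i))
    (mfderiv (𝓡 n) (𝓡 n) F x (basisVec j))

/-- The velocity of the curve `c` at time `t`. -/
def velocity (c : ℝ → M) (t : ℝ) : TangentSpace (𝓡 n) (c t) :=
  mfderiv 𝓘(ℝ, ℝ) (𝓡 n) c t (1 : ℝ)

/-- `c : ℝ → M` is a geodesic: it is smooth and solves the geodesic equation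
`c̈ⁱ + Γⁱ_{jk}(c) ċʲ ċᵏ = 0` in every local coordinate system. -/
def IsGeodesic (g : Metric n M) (c : ℝ → M) : Prop :=
  ContMDiff 𝓘(ℝ, ℝ) (𝓡 n) ∞ c ∧
  ∀ χ ∈ IsManifold.maximalAtlas (𝓡 n) ∞ M, ∀ t : ℝ, c t ∈ χ.source → ∀ i : Fin n,
    deriv (deriv (fun s => χ (c s) i)) t
      + ∑ j, ∑ k, christoffel (pullbackMetric g χ.symm) i j k (χ (c t))
          * deriv (fun s => χ (c s) j) t * deriv (fun s => χ (c s) k) t = 0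

/-- The components, in the chart `χ`, of a vector field `W` along the curve `c`. -/
def chartComponents (χ : OpenPartialHomeomorph M (V n)) (c : ℝ → M)
    (W : ∀ t, TangentSpace (𝓡 n) (c t)) (t : ℝ) : V n :=
  mfderiv (𝓡 n) (𝓡 n) χ (c t) (W t)

/-- `W` is parallel along `c`: in every local coordinate system
`Ẇⁱ + Γⁱ_{jk}(c) ċʲ Wᵏ = 0`. -/
def IsParallel (g : Metric n M) (c : ℝ → M) (W : ∀ t, TangentSpace (𝓡 n) (c t)) : Prop :=
  ∀ χ ∈ IsManifold.maximalAtlas (𝓡 n) ∞ M, ∀ t : ℝ, c t ∈ χ.source → ∀ i : Fin n,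
    HasDerivAt (fun s => chartComponents χ c W s i)
      (-∑ j, ∑ k, christoffel (pullbackMetric g χ.symm) i j k (χ (c t))
          * deriv (fun s => χ (c s) j) t * chartComponents χ c W t k) t

/-- `c` is a geodesic with initial point and initial velocity `w`. -/
def IsGeodesicFrom (g : Metric n M) (w : TangentBundle (𝓡 n) M) (c : ℝ → M) : Prop :=
  IsGeodesic g c ∧ (⟨c 0, velocity c 0⟩ : TangentBundle (𝓡 n) M) = w

/-- `(M, g)` is complete: geodesics with arbitrary initial data exist for all time. -/
def IsComplete (g : Metric n M) : Prop :=
  ∀ w : TangentBundle (𝓡 n) M, ∃ c : ℝ → M, IsGeodesicFrom g w c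

open Classical in
/-- The exponential map: the point at time `1` of the geodesic with initial data `w`. (The value
for initial data without a global geodesic is irrelevant on a complete manifold.) -/
def expMap (g : Metric n M) (w : TangentBundle (𝓡 n) M) : M :=
  if h : ∃ c : ℝ → M, IsGeodesicFrom g w c then h.choose 1 else w.proj

end Manifold

/-! ### Geodesic normal (Fermi) coordinates

The dimension of `M` is `k + 1`; the index `0 : Fin (k + 1)` is the direction of the geodesic and
the indices `m.succ`, `m : Fin k`, are the normal directions. -/

section Fermi

variable {k : ℕ} {M : Type*} [TopologicalSpace M] [ChartedSpace (V (k + 1)) M]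
  [IsManifold (𝓡 (k + 1)) ∞ M]

/-- The normal part `x⃗` of `x = (x¹, x⃗)`. -/
def normalPart (x : V (k + 1)) : V k := WithLp.toLp 2 (fun m : Fin k => x m.succ)

/-- The point `(s, 0⃗)`. -/
def axisPoint (s : ℝ) : V (k + 1) := EuclideanSpace.single 0 s

/-- `e` is a frame along `γ` obtained by parallel transport of an orthonormal basis of
`T_{γ(0)} M` whose first vector is `γ̇(0)`. -/
structure IsFermiFrame (g : Metric (k + 1) M) (γ : ℝ → M)
    (e : Fin (k + 1) → ∀ t, TangentSpace (𝓡 (k + 1)) (γ t)) : Prop where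
  parallel : ∀ i, IsParallel g γ (e i)
  first : e 0 0 = velocity γ 0
  orthonormal : ∀ i j, g.inner (γ 0) (e i 0) (e j 0) = if i = j then 1 else 0

/-- The normal exponential map `(x¹, x⃗) ↦ exp_{γ(x¹)} (∑_{m ≥ 2} xᵐ e_m(x¹))`. -/
def normalExp (g : Metric (k + 1) M) (γ : ℝ → M)
    (e : Fin (k + 1) → ∀ t, TangentSpace (𝓡 (k + 1)) (γ t)) (x : V (k + 1)) : M :=
  expMap g ⟨γ (x 0), ∑ m : Fin k, x m.succ • e m.succ (x 0)⟩

/-- The focal radius of `γ`: the largest radius (possibly infinite) such that the normal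
exponential map has no critical point on the normal disc bundle of that radius, that is, it is a
local diffeomorphism at each of its points. -/
def focalRadius (g : Metric (k + 1) M) (γ : ℝ → M)
    (e : Fin (k + 1) → ∀ t, TangentSpace (𝓡 (k + 1)) (γ t)) : ENNReal :=
  sSup {r : ENNReal | ∀ x : V (k + 1), ‖normalPart x‖ₑ < r →
    IsLocalDiffeomorphAt (𝓡 (k + 1)) (𝓡 (k + 1)) ∞ (normalExp g γ e) x}

/-- The coordinate domain `ℝ × 𝒩`, `𝒩 = {x⃗ : |x⃗| < r_foc}`. -/
def fermiDomain (g : Metric (k + 1) M) (γ : ℝ → M)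
    (e : Fin (k + 1) → ∀ t, TangentSpace (𝓡 (k + 1)) (γ t)) : Set (V (k + 1)) :=
  {x | ‖normalPart x‖ₑ < focalRadius g γ e}

/-- The coefficients of `g` in the geodesic normal coordinates. -/
def fermiMetric (g : Metric (k + 1) M) (γ : ℝ → M)
    (e : Fin (k + 1) → ∀ t, TangentSpace (𝓡 (k + 1)) (γ t)) :
    V (k + 1) → Matrix (Fin (k + 1)) (Fin (k + 1)) ℝ :=
  pullbackMetric g (normalExp g γ e)

end Fermi

/-! ### Minkowski space `ℝ^{1+d}` and the equations -/

/-- The Minkowski inner product `diag(-1, 1, …, 1)` of covectors. -/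
def mink {d : ℕ} (a b : Fin (d + 1) → ℝ) : ℝ := -(a 0 * b 0) + ∑ μ : Fin d, a μ.succ * b μ.succ

/-- The differential `(∂_μ v)_μ` of a function on `ℝ^{1+d}`. -/
def grad {d : ℕ} (v : V (d + 1) → ℝ) (y : V (d + 1)) : Fin (d + 1) → ℝ := fun μ => pderiv μ v y

/-- The d'Alembertian `□ v = -∂₀² v + ∑ ∂_μ² v`. -/
def box {d : ℕ} (v : V (d + 1) → ℝ) (y : V (d + 1)) : ℝ :=
  -pderiv 0 (pderiv 0 v) y + ∑ μ : Fin d, pderiv μ.succ (pderiv μ.succ v) y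

/-- The `i`-th component at `y` of the wave map operator
`□ φⁱ + Γⁱ_{jk}(φ) 𝔪(dφʲ, dφᵏ)` into the target metric `G`. -/
def waveMapOp {n d : ℕ} (G : V n → Matrix (Fin n) (Fin n) ℝ) (φ : V (d + 1) → V n) (i : Fin n)
    (y : V (d + 1)) : ℝ :=
  box (fun z => φ z i) y
    + ∑ j, ∑ l, christoffel G i j l (φ y) * mink (grad (fun z => φ z j) y) (grad (fun z => φ z l) y)

section Equations

variable {k d : ℕ}

/-- The perturbed map `φ = (ℓ + u¹, u⃗)`. -/
def perturbedMap (ell : V (d + 1) →ₗ[ℝ] ℝ) (u : V (d + 1) → V (k + 1)) (y : V (d + 1)) : V (k + 1) :=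
  axisPoint (ell y) + u y

/-- The differential `(∂_μ uⁱ)` of `u` at `y`. -/
def jet {n : ℕ} (u : V (d + 1) → V n) (y : V (d + 1)) : Fin n → Fin (d + 1) → ℝ :=
  fun i => grad (fun z => u z i) y

/-- `∑_{|A| = q, A ≠ (1,…,1)} (1/q!) ∂_A F(s, 0⃗) u^A`. -/
def mixedTaylor (q : ℕ) (F : V (k + 1) → ℝ) (s : ℝ) (u : V (k + 1)) : ℝ :=
  ∑ A : Fin q → Fin (k + 1) with A ≠ (fun _ => 0),
    ((q.factorial : ℝ))⁻¹ * multiDeriv A F (axisPoint s) * ∏ a, u (A a)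

/-- The explicit quadratic and cubic part of the `i`-th equation, in terms of `s = ℓ`, the values
`u`, the derivatives `p = ∂u` and the covector `dl = dℓ`. -/
def nonlinearity (G : V (k + 1) → Matrix (Fin (k + 1)) (Fin (k + 1)) ℝ) (dl : Fin (d + 1) → ℝ)
    (i : Fin (k + 1)) (s : ℝ) (u : V (k + 1)) (p : Fin (k + 1) → Fin (d + 1) → ℝ) : ℝ :=
  - 2 * (∑ m : Fin k, ∑ j, riemann G m.succ 0 j i (axisPoint s) * u m.succ * mink (p j) dl)
  - mixedTaylor 2 (christoffel G i 0 0) s u * mink dl dl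
  - (∑ m : Fin k, ∑ j, ∑ l,
      pderiv m.succ (christoffel G i j l) (axisPoint s) * u m.succ * mink (p j) (p l))
  - 2 * (∑ j, mixedTaylor 2 (christoffel G i j 0) s u * mink (p j) dl)
  - mixedTaylor 3 (christoffel G i 0 0) s u * mink dl dl

/-- The domain of the variables `(s, u, p)` standing for `(ℓ, u, ∂u)`, for `u` in the set `D`. -/
def jetDomain (d : ℕ) (D : Set (V (k + 1))) :
    Set (ℝ × V (k + 1) × (Fin (k + 1) → Fin (d + 1) → ℝ)) :=
  {z | z.2.1 ∈ D}

/-- The functions `h` are of higher order on `D` with coefficient `C`, a function of the parameter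
of the geodesic: `|hⁱ(s, u, p)| ≤ C(s) (|u|⁴ + |p|⁴) f(u, p)` with `f` smooth. -/
def IsHigherOrder (D : Set (V (k + 1))) (C : ℝ → ℝ)
    (h : Fin (k + 1) → ℝ × V (k + 1) × (Fin (k + 1) → Fin (d + 1) → ℝ) → ℝ) : Prop :=
  ∃ f : V (k + 1) × (Fin (k + 1) → Fin (d + 1) → ℝ) → ℝ,
    ContDiffOn ℝ ∞ f {w | w.1 ∈ D} ∧
    ∀ i, ∀ z ∈ jetDomain d D,
      |h i z| ≤ C z.1 * (‖z.2.1‖ ^ 4 + ‖z.2.2‖ ^ 4) * f z.2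

end Equations

end FermiWaveMap

end

/-!
The axis and the rays `t ↦ (s, t v)` are geodesics of the Fermi metric and the frame is parallel
along the axis, so by polarisation all Christoffel symbols `Γ` vanish on the axis, and with them
their `∂₁`-derivatives of every order. Expand `Γ(ℓ + u¹, u⃗)` in the wave map equation about the
point `(ℓ, 0)` of the axis, to order `3`, `2` or `1` according to whether `Γ` is multiplied by
`𝔪(dℓ, dℓ)`, `𝔪(du, dℓ)` or `𝔪(du, du)`. Since `Γ` vanishes on the axis, its linear coefficients
are curvatures, `∂ₘ Γⁱⱼ₁ = R_{m1ji}`; the one in the first equation vanishes, because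
`Γ¹₁₁ = ½ ∂₁ g₁₁` up to second order and `∂ₘ g₁₁ = 0` on the axis. The Taylor remainders are quartic
in `(u, ∂u)`, with coefficients bounded by derivatives of `Γ` on the segment from `(ℓ, 0)` to
`(ℓ + u¹, u⃗)`; a compact exhaustion separates such a bound into `C(ℓ) f(u)`.
-/

namespace FermiWaveMap

open Topology Filter

section PartialDerivatives

variable {n : ℕ} {f f' : V n → ℝ} {x : V n}

lemma sum_smul_basisVec (v : V n) : ∑ i, v i • basisVec i = v := by
  ext j
  simp [basisVec, Pi.single_apply]

lemma pderiv_congr (h : f =ᶠ[𝓝 x] f') (i : Fin n) : pderiv i f x = pderiv i f' x := by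
  rw [pderiv, pderiv, h.fderiv_eq]

lemma contDiffAt_pderiv {m N : WithTop ℕ∞} (hf : ContDiffAt ℝ N f x) (i : Fin n)
    (hmN : m + 1 ≤ N := by simp) : ContDiffAt ℝ m (pderiv i f) x :=
  (hf.fderiv_right hmN).clm_apply contDiffAt_const

lemma pderiv_comm (hf : ContDiffAt ℝ 2 f x) (i j : Fin n) :
    pderiv i (pderiv j f) x = pderiv j (pderiv i f) x := by
  have hd : DifferentiableAt ℝ (fderiv ℝ f) x :=
    (hf.fderiv_right (m := 1) one_add_one_eq_two.le).differentiableAt one_ne_zero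
  have h (a b : Fin n) : pderiv a (pderiv b f) x =
      fderiv ℝ (fderiv ℝ f) x (basisVec a) (basisVec b) :=
    DFunLike.congr_fun (fderiv_clm_apply hd (differentiableAt_const (basisVec b))) (basisVec a)
      |>.trans (by simp)
  rw [h, h]
  exact (hf.isSymmSndFDerivAt (by simp)).eq _ _

lemma pderiv_const_mul (hf : DifferentiableAt ℝ f x) (c : ℝ) (i : Fin n) :
    pderiv i (fun z => c * f z) x = c * pderiv i f x := by
  simp [pderiv, fderiv_const_mul hf]

lemma pderiv_sum_mul_of_eq_zero {ι : Type*} {s : Finset ι} {F F' : ι → V n → ℝ}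
    (hF : ∀ a ∈ s, DifferentiableAt ℝ (F a) x) (hF' : ∀ a ∈ s, DifferentiableAt ℝ (F' a) x)
    (h : ∀ a ∈ s, F' a x = 0) (i : Fin n) :
    pderiv i (fun z => ∑ a ∈ s, F a z * F' a z) x = ∑ a ∈ s, F a x * pderiv i (F' a) x := by
  rw [pderiv, fderiv_fun_sum (A := fun a z => F a z * F' a z) fun a ha => (hF a ha).mul (hF' a ha),
    FunLike.coe_sum, Finset.sum_apply]
  refine Finset.sum_congr rfl fun a ha => ?_
  simp [pderiv, fderiv_fun_mul (hF a ha) (hF' a ha), h a ha]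

end PartialDerivatives

section MatrixValued

variable {𝕜 E ι : Type*} [NontriviallyNormedField 𝕜] [NormedAddCommGroup E] [NormedSpace 𝕜 E]
  [Fintype ι] [DecidableEq ι] {m : WithTop ℕ∞} {A : E → Matrix ι ι 𝕜} {x : E}

lemma contDiffAt_det (hA : ∀ i j, ContDiffAt 𝕜 m (fun z => A z i j) x) :
    ContDiffAt 𝕜 m (fun z => (A z).det) x := by
  simp only [Matrix.det_apply']
  exact ContDiffAt.sum fun σ _ => contDiffAt_const.mul (contDiffAt_prod fun a _ => hA _ _)

lemma contDiffAt_matrix_inv (hA : ∀ i j, ContDiffAt 𝕜 m (fun z => A z i j) x)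
    (hdet : (A x).det ≠ 0) (i j : ι) : ContDiffAt 𝕜 m (fun z => (A z)⁻¹ i j) x := by
  have hadj : ContDiffAt 𝕜 m (fun z => (A z).adjugate i j) x := by
    simp only [Matrix.adjugate_apply]
    refine contDiffAt_det fun a b => ?_
    rcases eq_or_ne a j with rfl | h
    · simpa using contDiffAt_const
    · simpa [Matrix.updateRow_ne h] using hA a b
  simpa [Matrix.inv_def, Ring.inverse_eq_inv'] using ((contDiffAt_det hA).inv hdet).mul hadj

end MatrixValued

section Christoffel

variable {n : ℕ} {G : V n → Matrix (Fin n) (Fin n) ℝ} {x : V n}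

/-- The Christoffel symbol of the first kind `Γ_{l,jk} = ½ (∂_j G_{kl} + ∂_k G_{jl} - ∂_l G_{jk})`,
that is, `Γⁱ_{jk}` with its upper index lowered by the metric. -/
noncomputable def christoffelFirstKind (G : V n → Matrix (Fin n) (Fin n) ℝ) (l j k : Fin n)
    (x : V n) : ℝ :=
  (1 / 2) *
    (pderiv j (fun z => G z k l) x + pderiv k (fun z => G z j l) x - pderiv l (fun z => G z j k) x)

lemma christoffel_eq_inv_mulVec (G : V n → Matrix (Fin n) (Fin n) ℝ) (j k : Fin n) (x : V n) :
    (fun i => christoffel G i j k x) =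
      (G x)⁻¹.mulVec fun l => christoffelFirstKind G l j k x := by
  funext i
  simp only [christoffel, christoffelFirstKind, Matrix.mulVec, dotProduct, Finset.mul_sum]
  exact Finset.sum_congr rfl fun l _ => by ring

lemma mulVec_christoffel (hdet : (G x).det ≠ 0) (j k : Fin n) :
    (G x).mulVec (fun i => christoffel G i j k x) = fun l => christoffelFirstKind G l j k x := by
  rw [christoffel_eq_inv_mulVec, Matrix.mulVec_mulVec,
    Matrix.mul_nonsing_inv _ (isUnit_iff_ne_zero.2 hdet), Matrix.one_mulVec]

lemma christoffel_congr {G' : V n → Matrix (Fin n) (Fin n) ℝ} (h : G =ᶠ[𝓝 x] G')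
    (i j k : Fin n) : christoffel G i j k x = christoffel G' i j k x := by
  have hp (a b c : Fin n) : pderiv a (fun z => G z b c) x = pderiv a (fun z => G' z b c) x :=
    pderiv_congr (h.mono fun z hz => by rw [hz]) a
  simp only [christoffel, hp, h.eq_of_nhds]

lemma christoffel_symm (hG : ∀ z, (G z).IsSymm) (i j k : Fin n) :
    christoffel G i j k = christoffel G i k j := by
  funext x
  have hjk : (fun z => G z j k) = fun z => G z k j := funext fun z => (hG z).apply k j
  simp only [christoffel, hjk, add_comm]

lemma pderiv_metric_eq_add (hG : ∀ z, (G z).IsSymm) (a b c : Fin n) :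
    pderiv a (fun z => G z b c) x =
      christoffelFirstKind G c a b x + christoffelFirstKind G b a c x := by
  have hbc : (fun z => G z c b) = fun z => G z b c := funext fun z => (hG z).apply b c
  simp only [christoffelFirstKind, hbc]
  ring

lemma pderiv_metric_eq_zero (hG : ∀ z, (G z).IsSymm) (hdet : (G x).det ≠ 0)
    (h : ∀ i j k, christoffel G i j k x = 0) (a b c : Fin n) :
    pderiv a (fun z => G z b c) x = 0 := by
  have hfirst (l j k : Fin n) : christoffelFirstKind G l j k x = 0 := by
    rw [← congrFun (mulVec_christoffel hdet j k) l]
    simp [Matrix.mulVec, h]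
  rw [pderiv_metric_eq_add hG, hfirst, hfirst, add_zero]

lemma contDiffAt_christoffelFirstKind {m N : WithTop ℕ∞}
    (hG : ∀ i j, ContDiffAt ℝ N (fun z => G z i j) x) (l j k : Fin n)
    (hmN : m + 1 ≤ N := by simp) : ContDiffAt ℝ m (christoffelFirstKind G l j k) x :=
  contDiffAt_const.mul (((contDiffAt_pderiv (hG k l) j hmN).add
    (contDiffAt_pderiv (hG j l) k hmN)).sub (contDiffAt_pderiv (hG j k) l hmN))

lemma contDiffAt_christoffel {m N : WithTop ℕ∞} (hG : ∀ i j, ContDiffAt ℝ N (fun z => G z i j) x)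
    (hdet : (G x).det ≠ 0) (i j k : Fin n) (hmN : m + 1 ≤ N := by simp) :
    ContDiffAt ℝ m (christoffel G i j k) x := by
  have heq : christoffel G i j k = fun z => ∑ l, (G z)⁻¹ i l * christoffelFirstKind G l j k z :=
    funext fun z => congrFun (christoffel_eq_inv_mulVec G j k z) i
  rw [heq]
  exact ContDiffAt.sum fun l _ =>
    (contDiffAt_matrix_inv (fun a b => (hG a b).of_le (le_self_add.trans hmN)) hdet i l).mul
      (contDiffAt_christoffelFirstKind hG l j k hmN)

lemma pderiv_christoffel_eq_pderiv_christoffelFirstKind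
    (hG : ∀ i j, ContDiffAt ℝ 2 (fun z => G z i j) x) (hone : G x = 1) {j k : Fin n}
    (h : ∀ i, christoffel G i j k x = 0) (a i : Fin n) :
    pderiv a (christoffel G i j k) x = pderiv a (christoffelFirstKind G i j k) x := by
  have hdet : (G x).det ≠ 0 := by simp [hone]
  have hlower : christoffelFirstKind G i j k =ᶠ[𝓝 x]
      fun z => ∑ l, G z i l * christoffel G l j k z :=
    ((contDiffAt_det hG).continuousAt.eventually_ne hdet).mono fun z hz =>
      (congrFun (mulVec_christoffel hz j k) i).symm
  rw [pderiv_congr hlower, pderiv_sum_mul_of_eq_zero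
    (fun l _ => (hG i l).differentiableAt two_ne_zero)
    (fun l _ => (contDiffAt_christoffel (m := 1) hG hdet l j k
      one_add_one_eq_two.le).differentiableAt one_ne_zero) fun l _ => h l]
  simp [hone, Matrix.one_apply]

end Christoffel

section TangentLift

variable {n : ℕ} {M : Type*} [TopologicalSpace M] [ChartedSpace (V n) M]

/-- The lift `t ↦ (c t, ċ t)` of the curve `c` to the tangent bundle. Equalities between vectors
at different base points are stated in the tangent bundle. -/
noncomputable def tangentLift (c : ℝ → M) (t : ℝ) : TangentBundle (𝓡 n) M :=
  ⟨c t, velocity c t⟩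

lemma tangentLift_comp {F : V n → M} {c : ℝ → V n} {t : ℝ} {x v : V n} (hc : HasDerivAt c v t)
    (hx : c t = x) (hF : MDifferentiableAt (𝓡 n) (𝓡 n) F x) :
    tangentLift (fun s => F (c s)) t = tangentMap (𝓡 n) (𝓡 n) F ⟨x, v⟩ := by
  subst hx
  have hchain := DFunLike.congr_fun (hF.hasMFDerivAt.comp t hc.hasFDerivAt.hasMFDerivAt).mfderiv
    (1 : ℝ)
  refine congrArg (Bundle.TotalSpace.mk (F (c t))) (hchain.trans ?_)
  exact congrArg (mfderiv (𝓡 n) (𝓡 n) F (c t) : V n →L[ℝ] V n) (one_smul ℝ v)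

lemma tangentLift_comp_mul {c : ℝ → M} {a t : ℝ}
    (hc : MDifferentiableAt 𝓘(ℝ, ℝ) (𝓡 n) c (a * t)) :
    tangentLift (n := n) (fun s => c (a * s)) t =
      ⟨(tangentLift (n := n) c (a * t)).proj, a • (tangentLift (n := n) c (a * t)).2⟩ := by
  have hmul : HasMFDerivAt 𝓘(ℝ, ℝ) 𝓘(ℝ, ℝ) (fun s : ℝ => a * s) t
      (ContinuousLinearMap.toSpanSingleton ℝ a) :=
    ((hasDerivAt_id t).const_mul a |>.congr_deriv (mul_one a)).hasFDerivAt.hasMFDerivAt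
  have hchain := DFunLike.congr_fun (hc.hasMFDerivAt.comp t hmul).mfderiv (1 : ℝ)
  refine congrArg (Bundle.TotalSpace.mk (c (a * t))) (hchain.trans ?_)
  let L : ℝ →L[ℝ] V n := mfderiv 𝓘(ℝ, ℝ) (𝓡 n) c (a * t)
  exact (congrArg L (show ContinuousLinearMap.toSpanSingleton ℝ a (1 : ℝ) = a • (1 : ℝ) by
    simp)).trans (map_smul L a 1)

variable {χ : OpenPartialHomeomorph M (V n)}

lemma chart_mdifferentiable (hχ : χ ∈ IsManifold.maximalAtlas (𝓡 n) ∞ M) :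
    χ.MDifferentiable (𝓡 n) (𝓡 n) :=
  ⟨(contMDiffOn_of_mem_maximalAtlas hχ).mdifferentiableOn (by simp),
    (contMDiffOn_symm_of_mem_maximalAtlas hχ).mdifferentiableOn (by simp)⟩

lemma deriv_chart_comp (hχ : χ ∈ IsManifold.maximalAtlas (𝓡 n) ∞ M) {c : ℝ → M} {t : ℝ}
    (hc : MDifferentiableAt 𝓘(ℝ, ℝ) (𝓡 n) c t) (ht : c t ∈ χ.source) :
    deriv (fun s => χ (c s)) t = (tangentMap (𝓡 n) (𝓡 n) χ (tangentLift c t)).2 := by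
  have h := mfderiv_comp t ((chart_mdifferentiable hχ).mdifferentiableAt ht) hc
  rw [mfderiv_eq_fderiv] at h
  exact DFunLike.congr_fun h (1 : ℝ)

end TangentLift

section Pullback

variable {n : ℕ} {M : Type*} [TopologicalSpace M] [ChartedSpace (V n) M] [IsManifold (𝓡 n) ∞ M]

lemma pullbackMetric_isSymm (g : Metric n M) (F : V n → M) (x : V n) :
    (pullbackMetric g F x).IsSymm :=
  Matrix.IsSymm.ext fun _ _ => g.symm _ _ _

lemma pullbackMetric_congr (g : Metric n M) {F F' : V n → M} {x : V n} (h : F =ᶠ[𝓝 x] F') :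
    pullbackMetric g F =ᶠ[𝓝 x] pullbackMetric g F' := by
  filter_upwards [h.eventuallyEq_nhds] with z hz
  ext i j
  have hbase : F z = F' z := hz.eq_of_nhds
  simp only [pullbackMetric, hz.mfderiv_eq (I := 𝓡 n) (I' := 𝓡 n)]
  congr!

lemma pullbackMetric_apply_of_tangentMap_eq {g : Metric n M} {F : V n → M} {x : V n} {p : M}
    {v w : TangentSpace (𝓡 n) p} {i j : Fin n}
    (hv : tangentMap (𝓡 n) (𝓡 n) F ⟨x, basisVec i⟩ = ⟨p, v⟩)
    (hw : tangentMap (𝓡 n) (𝓡 n) F ⟨x, basisVec j⟩ = ⟨p, w⟩) :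
    pullbackMetric g F x i j = g.inner p v w := by
  cases hv
  cases hw
  rfl

lemma contDiffAt_pullbackMetric (g : Metric n M) {F : V n → M} {U : Set (V n)} (hU : IsOpen U)
    (hF : ContMDiffOn (𝓡 n) (𝓡 n) ∞ F U) {x : V n} (hx : x ∈ U) (i j : Fin n) :
    ContDiffAt ℝ ∞ (fun z => pullbackMetric g F z i j) x := by
  have htangent : ContMDiffOn (𝓡 n).tangent (𝓡 n).tangent ∞ (tangentMapWithin (𝓡 n) (𝓡 n) F U)
      (Bundle.TotalSpace.proj ⁻¹' U) :=
    hF.contMDiffOn_tangentMapWithin (by simp) hU.uniqueMDiffOn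
  have hbasis (a : Fin n) : ContMDiffAt (𝓡 n) (𝓡 n).tangent ∞
      (fun z : V n => (⟨z, basisVec a⟩ : TangentBundle (𝓡 n) (V n))) x :=
    contMDiffAt_vectorSpace_iff_contDiffAt.2 contDiffAt_const
  have hpush (a : Fin n) : ContMDiffAt (𝓡 n) (𝓡 n).tangent ∞
      (fun z => tangentMap (𝓡 n) (𝓡 n) F ⟨z, basisVec a⟩) x := by
    have hat : ContMDiffAt (𝓡 n).tangent (𝓡 n).tangent ∞ (tangentMapWithin (𝓡 n) (𝓡 n) F U)
        (⟨x, basisVec a⟩ : TangentBundle (𝓡 n) (V n)) :=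
      htangent.contMDiffAt ((hU.preimage (FiberBundle.continuous_proj _ _)).mem_nhds hx)
    refine (ContMDiffAt.comp x hat (hbasis a)).congr_of_eventuallyEq ?_
    filter_upwards [hU.mem_nhds hx] with z hz
    simp [tangentMapWithin, tangentMap, mfderivWithin_of_isOpen hU hz]
  have hinner : ContMDiffAt (𝓡 n) ((𝓡 n).prod 𝓘(ℝ)) ∞
      (fun z ↦ Bundle.TotalSpace.mk' ℝ (E := Bundle.Trivial M ℝ) (F z)
        (g.inner (F z) (mfderiv (𝓡 n) (𝓡 n) F z (basisVec i))
          (mfderiv (𝓡 n) (𝓡 n) F z (basisVec j)))) x :=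
    ContMDiffAt.clm_bundle_apply₂ (F₁ := V n) (F₂ := V n)
      (g.contMDiff.contMDiffAt.comp x (hF.contMDiffAt (hU.mem_nhds hx))) (hpush i) (hpush j)
  exact contMDiffAt_iff_contDiffAt.1 (Bundle.contMDiffAt_totalSpace.1 hinner).2

lemma dotProduct_pullbackMetric_mulVec (g : Metric n M) (F : V n → M) (x v : V n) :
    (v : Fin n → ℝ) ⬝ᵥ (pullbackMetric g F x).mulVec v =
      g.inner (F x) (mfderiv (𝓡 n) (𝓡 n) F x v) (mfderiv (𝓡 n) (𝓡 n) F x v) := by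
  let L : V n →L[ℝ] TangentSpace (𝓡 n) (F x) := mfderiv (𝓡 n) (𝓡 n) F x
  have hL : L v = ∑ i, v i • L (basisVec i) := by
    conv_lhs => rw [← sum_smul_basisVec v, map_sum]
    simp only [map_smul]
  change _ = g.inner (F x) (L v) (L v)
  simp only [hL, map_sum, map_smul, FunLike.coe_sum, Finset.sum_apply, FunLike.coe_smul,
    Pi.smul_apply, smul_eq_mul, dotProduct, Matrix.mulVec, Finset.mul_sum]
  rw [Finset.sum_comm]
  exact Finset.sum_congr rfl fun i _ => Finset.sum_congr rfl fun j _ => by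
    rw [mul_comm (pullbackMetric g F x j i), mul_left_comm]; rfl

lemma det_pullbackMetric_ne_zero (g : Metric n M) {F : V n → M} {x : V n}
    (hF : Function.Injective (mfderiv (𝓡 n) (𝓡 n) F x)) : (pullbackMetric g F x).det ≠ 0 := by
  intro hdet
  obtain ⟨v, hv, hker⟩ := Matrix.exists_mulVec_eq_zero_iff.2 hdet
  have hne : mfderiv (𝓡 n) (𝓡 n) F x (WithLp.toLp 2 v : V n) ≠ 0 := fun h0 => by
    have h := hF (h0.trans (map_zero (mfderiv (𝓡 n) (𝓡 n) F x)).symm)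
    exact hv (congrArg WithLp.ofLp h)
  refine (g.pos _ _ hne).ne' ?_
  rw [← dotProduct_pullbackMetric_mulVec]
  simp [hker]

end Pullback

section GeodesicODE

variable {n : ℕ} {M : Type*} [TopologicalSpace M] {χ : OpenPartialHomeomorph M (V n)}
  {c c₁ c₂ : ℝ → M} {t : ℝ}

lemma deriv_apply {x : ℝ → V n} (hx : DifferentiableAt ℝ x t) (i : Fin n) :
    deriv (fun s => x s i) t = deriv x t i :=
  ((EuclideanSpace.proj (𝕜 := ℝ) i).hasFDerivAt.comp_hasDerivAt t hx.hasDerivAt).deriv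

/-- The vector field `(x, v) ↦ (v, -Γ(x)(v, v))` of the geodesic flow in coordinates. -/
noncomputable def geodesicField (Γ : Fin n → Fin n → Fin n → V n → ℝ) (z : V n × V n) :
    V n × V n :=
  (z.2, WithLp.toLp 2 fun i => -∑ j, ∑ k, Γ i j k z.1 * z.2 j * z.2 k)

lemma contDiffAt_geodesicField {Γ : Fin n → Fin n → Fin n → V n → ℝ} {z : V n × V n}
    {N : WithTop ℕ∞} (hΓ : ∀ i j k, ContDiffAt ℝ N (Γ i j k) z.1) :
    ContDiffAt ℝ N (geodesicField Γ) z := by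
  have hcoord (j : Fin n) : ContDiffAt ℝ N (fun w : V n × V n => w.2 j) z :=
    (EuclideanSpace.proj (𝕜 := ℝ) j).contDiff.contDiffAt.comp z contDiffAt_snd
  refine contDiffAt_snd.prodMk (contDiffAt_euclidean.2 fun i => ?_)
  refine ContDiffAt.neg (ContDiffAt.sum fun j _ => ContDiffAt.sum fun k _ => ?_)
  exact (((hΓ i j k).comp z contDiffAt_fst).mul (hcoord j)).mul (hcoord k)

/-- Position and velocity of the curve `c` in the chart `χ`, a point of the phase space of the
geodesic flow. -/
noncomputable def chartPhase (χ : OpenPartialHomeomorph M (V n)) (c : ℝ → M) (t : ℝ) :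
    V n × V n :=
  (χ (c t), deriv (fun s => χ (c s)) t)

lemma chartPhase_congr (h : c₁ =ᶠ[𝓝 t] c₂) : chartPhase χ c₁ t = chartPhase χ c₂ t :=
  Prod.ext (congrArg χ h.eq_of_nhds) (h.fun_comp χ).deriv_eq

variable [ChartedSpace (V n) M]

lemma contDiffAt_chart_comp (hχ : χ ∈ IsManifold.maximalAtlas (𝓡 n) ∞ M)
    (hc : ContMDiff 𝓘(ℝ, ℝ) (𝓡 n) ∞ c) (ht : c t ∈ χ.source) :
    ContDiffAt ℝ ∞ (fun s => χ (c s)) t :=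
  contMDiffAt_iff_contDiffAt.1
    ((contMDiffAt_of_mem_maximalAtlas hχ ht).comp t hc.contMDiffAt)

lemma chartPhase_eq_of_tangentLift_eq (hχ : χ ∈ IsManifold.maximalAtlas (𝓡 n) ∞ M)
    (hc₁ : MDifferentiableAt 𝓘(ℝ, ℝ) (𝓡 n) c₁ t) (hc₂ : MDifferentiableAt 𝓘(ℝ, ℝ) (𝓡 n) c₂ t)
    (ht : c₁ t ∈ χ.source) (h : tangentLift (n := n) c₁ t = tangentLift c₂ t) :
    chartPhase χ c₁ t = chartPhase χ c₂ t := by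
  have hpt : c₁ t = c₂ t := congrArg Bundle.TotalSpace.proj h
  refine Prod.ext (congrArg χ hpt) ?_
  simp only [chartPhase]
  rw [deriv_chart_comp hχ hc₁ ht, deriv_chart_comp hχ hc₂ (hpt ▸ ht), h]

variable [IsManifold (𝓡 n) ∞ M] {g : Metric n M}

lemma contDiffAt_chart_christoffel (g : Metric n M)
    (hχ : χ ∈ IsManifold.maximalAtlas (𝓡 n) ∞ M) {x : V n} (hx : x ∈ χ.target) (i j k : Fin n) :
    ContDiffAt ℝ ∞ (christoffel (pullbackMetric g χ.symm) i j k) x :=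
  contDiffAt_christoffel
    (contDiffAt_pullbackMetric g χ.open_target (contMDiffOn_symm_of_mem_maximalAtlas hχ) hx)
    (det_pullbackMetric_ne_zero g ((chart_mdifferentiable hχ).symm.mfderiv_injective hx)) i j k

lemma IsGeodesic.mdifferentiableAt (hc : IsGeodesic g c) (t : ℝ) :
    MDifferentiableAt 𝓘(ℝ, ℝ) (𝓡 n) c t :=
  hc.1.mdifferentiableAt (by simp)

lemma IsGeodesic.eventually_mem_source (hc : IsGeodesic g c) (ht : c t ∈ χ.source) :
    ∀ᶠ s in 𝓝 t, c s ∈ χ.source :=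
  hc.1.continuous.continuousAt.eventually_mem (χ.open_source.mem_nhds ht)

lemma IsGeodesic.hasDerivAt_chartPhase (hc : IsGeodesic g c)
    (hχ : χ ∈ IsManifold.maximalAtlas (𝓡 n) ∞ M) (ht : c t ∈ χ.source) :
    HasDerivAt (chartPhase χ c)
      (geodesicField (christoffel (pullbackMetric g χ.symm)) (chartPhase χ c t)) t := by
  have hx := contDiffAt_chart_comp hχ hc.1 ht
  have hx' : DifferentiableAt ℝ (deriv fun r => χ (c r)) t :=
    ((hx.fderiv_right (m := ∞) (by simp)).clm_apply contDiffAt_const).differentiableAt (by simp)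
  have hcoord : ∀ᶠ s in 𝓝 t, ∀ j, deriv (fun r => χ (c r) j) s = deriv (fun r => χ (c r)) s j := by
    filter_upwards [hc.eventually_mem_source ht] with s hs j
    exact deriv_apply ((contDiffAt_chart_comp hχ hc.1 hs).differentiableAt (by simp)) j
  refine (hx.differentiableAt (by simp)).hasDerivAt.prodMk ?_
  convert hx'.hasDerivAt using 1
  ext i
  have hgeodesic := hc.2 χ hχ t ht i
  have hsecond : deriv (deriv fun r => χ (c r) i) t = deriv (deriv fun r => χ (c r)) t i := by
    rw [← deriv_apply hx']
    exact EventuallyEq.deriv_eq (hcoord.mono fun s hs => hs i)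
  simp only [hsecond, hcoord.self_of_nhds] at hgeodesic
  exact (eq_neg_of_add_eq_zero_left hgeodesic).symm

lemma IsGeodesic.eventuallyEq (h₁ : IsGeodesic g c₁) (h₂ : IsGeodesic g c₂)
    (hχ : χ ∈ IsManifold.maximalAtlas (𝓡 n) ∞ M) (ht₁ : c₁ t ∈ χ.source) (ht₂ : c₂ t ∈ χ.source)
    (h : chartPhase χ c₁ t = chartPhase χ c₂ t) : c₁ =ᶠ[𝓝 t] c₂ := by
  have hsmooth : ContDiffAt ℝ 1 (geodesicField (christoffel (pullbackMetric g χ.symm)))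
      (chartPhase χ c₁ t) :=
    (contDiffAt_geodesicField fun i j k =>
      contDiffAt_chart_christoffel g hχ (χ.map_source ht₁) i j k).of_le (by simp)
  obtain ⟨K, s, hs, hK⟩ := hsmooth.exists_lipschitzOnWith
  have hsolution (c : ℝ → M) (hc : IsGeodesic g c) (hct : c t ∈ χ.source)
      (hst : s ∈ 𝓝 (chartPhase χ c t)) : ∀ᶠ r in 𝓝 t, HasDerivAt (chartPhase χ c)
        (geodesicField (christoffel (pullbackMetric g χ.symm)) (chartPhase χ c r)) r ∧
          chartPhase χ c r ∈ s := by
    filter_upwards [hc.eventually_mem_source hct,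
      (hc.hasDerivAt_chartPhase hχ hct).continuousAt.eventually_mem hst] with r hr hrs
    exact ⟨hc.hasDerivAt_chartPhase hχ hr, hrs⟩
  have hphase : chartPhase χ c₁ =ᶠ[𝓝 t] chartPhase χ c₂ := ODE_solution_unique_of_eventually
    (v := fun _ => geodesicField (christoffel (pullbackMetric g χ.symm))) (s := fun _ => s)
    (Eventually.of_forall fun _ => hK) (hsolution c₁ h₁ ht₁ hs) (hsolution c₂ h₂ ht₂ (h ▸ hs)) h
  filter_upwards [hphase, h₁.eventually_mem_source ht₁, h₂.eventually_mem_source ht₂]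
    with r hr hr₁ hr₂
  exact χ.injOn hr₁ hr₂ (congrArg Prod.fst hr)

lemma isClosed_setOf_isGeodesic_eventuallyEq [T2Space M] (h₁ : IsGeodesic g c₁)
    (h₂ : IsGeodesic g c₂) : IsClosed {t : ℝ | c₁ =ᶠ[𝓝 t] c₂} := by
  refine isClosed_of_closure_subset fun t ht => ?_
  have hpt : c₁ t = c₂ t :=
    closure_minimal (fun s hs => Eventually.self_of_nhds hs)
      (isClosed_eq h₁.1.continuous h₂.1.continuous) ht
  have hχ : chartAt (V n) (c₁ t) ∈ IsManifold.maximalAtlas (𝓡 n) ∞ M :=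
    IsManifold.chart_mem_maximalAtlas _
  have hmem := mem_chart_source (V n) (c₁ t)
  refine h₁.eventuallyEq h₂ hχ hmem (hpt ▸ hmem) ?_
  exact tendsto_nhds_unique_of_frequently_eq
    (h₁.hasDerivAt_chartPhase hχ hmem).continuousAt
    (h₂.hasDerivAt_chartPhase hχ (hpt ▸ hmem)).continuousAt
    ((mem_closure_iff_frequently.1 ht).mono fun s hs => chartPhase_congr hs)

theorem IsGeodesicFrom.unique [T2Space M] {w : TangentBundle (𝓡 n) M}
    (h₁ : IsGeodesicFrom g w c₁) (h₂ : IsGeodesicFrom g w c₂) : c₁ = c₂ := by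
  have hlift : tangentLift (n := n) c₁ 0 = tangentLift c₂ 0 := h₁.2.trans h₂.2.symm
  have hpt : c₁ 0 = c₂ 0 := congrArg Bundle.TotalSpace.proj hlift
  have hχ : chartAt (V n) (c₁ 0) ∈ IsManifold.maximalAtlas (𝓡 n) ∞ M :=
    IsManifold.chart_mem_maximalAtlas _
  have hmem := mem_chart_source (V n) (c₁ 0)
  have hzero : c₁ =ᶠ[𝓝 (0 : ℝ)] c₂ := h₁.1.eventuallyEq h₂.1 hχ hmem (hpt ▸ hmem)
    (chartPhase_eq_of_tangentLift_eq hχ (h₁.1.mdifferentiableAt 0) (h₂.1.mdifferentiableAt 0)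
      hmem hlift)
  have huniv : {t : ℝ | c₁ =ᶠ[𝓝 t] c₂} = Set.univ := IsClopen.eq_univ
    ⟨isClosed_setOf_isGeodesic_eventuallyEq h₁.1 h₂.1, isOpen_setOfPred_eventually_nhds⟩ ⟨0, hzero⟩
  funext t
  exact (Set.eq_univ_iff_forall.1 huniv t).eq_of_nhds

lemma IsGeodesic.comp_mul (hc : IsGeodesic g c) (a : ℝ) : IsGeodesic g (fun t => c (a * t)) := by
  refine ⟨hc.1.comp (contDiff_const.mul contDiff_id).contMDiff, fun χ hχ t ht i => ?_⟩
  have hfirst (j : Fin n) : deriv (fun s => χ (c (a * s)) j) =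
      fun s => a * deriv (fun s => χ (c s) j) (a * s) := by
    funext s
    exact deriv_comp_mul_left a (fun s => χ (c s) j) s
  have hsecond : deriv (fun s => a * deriv (fun s => χ (c s) i) (a * s)) t =
      a * (a * deriv (deriv (fun s => χ (c s) i)) (a * t)) := by
    rw [deriv_const_mul_field]
    exact congrArg (a * ·) (deriv_comp_mul_left a (deriv fun s => χ (c s) i) t)
  rw [hfirst i, hsecond]
  simp only [hfirst]
  rw [← mul_zero (a * a), ← hc.2 χ hχ (a * t) ht i, mul_add, Finset.mul_sum]
  refine congrArg₂ _ (by ring) (Finset.sum_congr rfl fun j _ => ?_)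
  rw [Finset.mul_sum]
  exact Finset.sum_congr rfl fun k _ => by ring

lemma IsGeodesicFrom.comp_mul {w : TangentBundle (𝓡 n) M} (hc : IsGeodesicFrom g w c) (a : ℝ) :
    IsGeodesicFrom g ⟨w.proj, a • w.2⟩ (fun t => c (a * t)) := by
  obtain ⟨hgeodesic, rfl⟩ := hc
  refine ⟨hgeodesic.comp_mul a, (tangentLift_comp_mul (hgeodesic.mdifferentiableAt _)).trans ?_⟩
  rw [mul_zero]
  rfl

lemma expMap_eq [T2Space M] {w : TangentBundle (𝓡 n) M} (hc : IsGeodesicFrom g w c) :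
    expMap g w = c 1 := by
  have hex : ∃ c : ℝ → M, IsGeodesicFrom g w c := ⟨c, hc⟩
  rw [expMap, dif_pos hex, hex.choose_spec.unique hc]

lemma expMap_smul [T2Space M] {w : TangentBundle (𝓡 n) M} (hc : IsGeodesicFrom g w c) (t : ℝ) :
    expMap g ⟨w.proj, t • w.2⟩ = c t :=
  (expMap_eq (hc.comp_mul t)).trans (congrArg c (mul_one t))

end GeodesicODE

section LocalParametrisation

variable {n : ℕ} {M : Type*} [TopologicalSpace M] [ChartedSpace (V n) M]
  {χ : OpenPartialHomeomorph M (V n)} {F : V n → M} {x : V n}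

/-- The smooth chart `χ` inverts the local parametrisation `F` on the target of `χ`. Charts of this
kind carry the definitions of `IsGeodesic` and `IsParallel` over to the coordinates given by a local
diffeomorphism `F`. -/
structure IsLocalInverse (χ : OpenPartialHomeomorph M (V n)) (F : V n → M) : Prop where
  mem_maximalAtlas : χ ∈ IsManifold.maximalAtlas (𝓡 n) ∞ M
  eqOn : Set.EqOn F χ.symm χ.target

namespace IsLocalInverse

lemma map_mem_source (hχ : IsLocalInverse χ F) (hx : x ∈ χ.target) : F x ∈ χ.source :=
  hχ.eqOn hx ▸ χ.map_target hx

lemma chart_apply (hχ : IsLocalInverse χ F) (hx : x ∈ χ.target) : χ (F x) = x :=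
  (congrArg χ (hχ.eqOn hx)).trans (χ.right_inv hx)

lemma eventually_chart_comp_eq (hχ : IsLocalInverse χ F) {y : ℝ → V n} {t : ℝ}
    (hy : ContinuousAt y t) (ht : y t ∈ χ.target) : ∀ᶠ s in 𝓝 t, χ (F (y s)) = y s :=
  (hy.eventually_mem (χ.open_target.mem_nhds ht)).mono fun _ hs => hχ.chart_apply hs

lemma tangentMap_tangentMap (hχ : IsLocalInverse χ F)
    (hF : MDifferentiableAt (𝓡 n) (𝓡 n) F x) (hx : x ∈ χ.target) (v : TangentSpace (𝓡 n) x) :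
    (tangentMap (𝓡 n) (𝓡 n) χ (tangentMap (𝓡 n) (𝓡 n) F ⟨x, v⟩)).2 = v := by
  have hchain := mfderiv_comp x
    ((chart_mdifferentiable hχ.mem_maximalAtlas).mdifferentiableAt (hχ.map_mem_source hx)) hF
  have hid : χ ∘ F =ᶠ[𝓝 x] id := by
    filter_upwards [χ.open_target.mem_nhds hx] with z hz using hχ.chart_apply hz
  rw [hid.mfderiv_eq, mfderiv_id] at hchain
  exact (DFunLike.congr_fun hchain v).symm

variable [IsManifold (𝓡 n) ∞ M]

lemma christoffel_pullbackMetric (hχ : IsLocalInverse χ F) (g : Metric n M) (hx : x ∈ χ.target)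
    (i j k : Fin n) :
    christoffel (pullbackMetric g χ.symm) i j k x = christoffel (pullbackMetric g F) i j k x :=
  christoffel_congr
    (pullbackMetric_congr g (hχ.eqOn.eventuallyEq_of_mem (χ.open_target.mem_nhds hx)).symm) i j k

end IsLocalInverse

variable [IsManifold (𝓡 n) ∞ M] {g : Metric n M}

lemma exists_isLocalInverse (hF : IsLocalDiffeomorphAt (𝓡 n) (𝓡 n) ∞ F x) :
    ∃ χ, IsLocalInverse χ F ∧ x ∈ χ.target := by
  obtain ⟨Φ, hxΦ, hΦ⟩ := hF
  exact ⟨Φ.toOpenPartialHomeomorph.symm, ⟨OpenPartialHomeomorph.mem_maximalAtlas_of_contMDiffOn _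
    Φ.contMDiffOn_invFun Φ.contMDiffOn_toFun, hΦ⟩, hxΦ⟩

lemma contDiffAt_pullbackMetric_of_isLocalDiffeomorphAt (g : Metric n M)
    (hF : IsLocalDiffeomorphAt (𝓡 n) (𝓡 n) ∞ F x) (i j : Fin n) :
    ContDiffAt ℝ ∞ (fun z => pullbackMetric g F z i j) x := by
  obtain ⟨χ, hχ, hx⟩ := exists_isLocalInverse hF
  exact contDiffAt_pullbackMetric g χ.open_target
    ((contMDiffOn_symm_of_mem_maximalAtlas hχ.mem_maximalAtlas).congr hχ.eqOn) hx i j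

lemma det_pullbackMetric_ne_zero_of_isLocalDiffeomorphAt (g : Metric n M)
    (hF : IsLocalDiffeomorphAt (𝓡 n) (𝓡 n) ∞ F x) : (pullbackMetric g F x).det ≠ 0 :=
  det_pullbackMetric_ne_zero g (hF.mfderivToContinuousLinearEquiv (by simp)).injective

variable {c : ℝ → M} {y w : ℝ → V n} {t : ℝ}

lemma IsGeodesic.coordinate_equation (hc : IsGeodesic g c) (hy : ContinuousAt y t)
    (hF : IsLocalDiffeomorphAt (𝓡 n) (𝓡 n) ∞ F (y t)) (h : ∀ s, c s = F (y s)) (i : Fin n) :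
    deriv (deriv fun s => y s i) t + ∑ j, ∑ k, christoffel (pullbackMetric g F) i j k (y t)
      * deriv (fun s => y s j) t * deriv (fun s => y s k) t = 0 := by
  obtain ⟨χ, hχ, ht⟩ := exists_isLocalInverse hF
  have hcoord (j : Fin n) : (fun s => χ (c s) j) =ᶠ[𝓝 t] fun s => y s j :=
    (hχ.eventually_chart_comp_eq hy ht).mono fun s hs => by simp only [h, hs]
  have hgeodesic := hc.2 χ hχ.mem_maximalAtlas t (h t ▸ hχ.map_mem_source ht) i
  simpa only [(hcoord i).deriv.deriv_eq, (hcoord _).deriv_eq, h t, hχ.chart_apply ht,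
    hχ.christoffel_pullbackMetric g ht] using hgeodesic

lemma IsParallel.hasDerivAt_coordinate {W : ∀ t, TangentSpace (𝓡 n) (c t)}
    (hW : IsParallel g c W) (hy : ContinuousAt y t)
    (hF : ∀ s, IsLocalDiffeomorphAt (𝓡 n) (𝓡 n) ∞ F (y s))
    (h : ∀ s, tangentMap (𝓡 n) (𝓡 n) F ⟨y s, w s⟩ = ⟨c s, W s⟩) (i : Fin n) :
    HasDerivAt (fun s => w s i) (-∑ j, ∑ k, christoffel (pullbackMetric g F) i j k (y t)
      * deriv (fun s => y s j) t * w t k) t := by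
  obtain ⟨χ, hχ, ht⟩ := exists_isLocalInverse (hF t)
  have hbase (s : ℝ) : F (y s) = c s := congrArg Bundle.TotalSpace.proj (h s)
  have hcoord (j : Fin n) : (fun s => χ (c s) j) =ᶠ[𝓝 t] fun s => y s j :=
    (hχ.eventually_chart_comp_eq hy ht).mono fun s hs => by simp only [← hbase, hs]
  have hcomponents : ∀ᶠ s in 𝓝 t, chartComponents χ c W s = w s := by
    filter_upwards [hy.eventually_mem (χ.open_target.mem_nhds ht)] with s hs
    have hlift := hχ.tangentMap_tangentMap ((hF s).mdifferentiableAt (by simp)) hs (w s)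
    rw [h s] at hlift
    exact hlift
  have hparallel := hW χ hχ.mem_maximalAtlas t (hbase t ▸ hχ.map_mem_source ht) i
  simp only [(hcoord _).deriv_eq, ← hbase t, hχ.chart_apply ht, hcomponents.self_of_nhds,
    hχ.christoffel_pullbackMetric g ht] at hparallel
  exact hparallel.congr_of_eventuallyEq (hcomponents.mono fun s hs => by simp only [hs])

end LocalParametrisation

section Axis

variable {k : ℕ}

@[simp] lemma axisPoint_zero_apply (s : ℝ) : axisPoint (k := k) s 0 = s := by simp [axisPoint]

@[simp] lemma axisPoint_succ_apply (s : ℝ) (m : Fin k) : axisPoint s m.succ = 0 := by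
  simp [axisPoint]

lemma axisPoint_eq_smul (s : ℝ) : axisPoint (k := k) s = s • basisVec 0 := by
  ext i
  simp [axisPoint, basisVec]

@[simp] lemma normalPart_axisPoint (s : ℝ) : normalPart (axisPoint (k := k) s) = 0 := by
  ext m
  simp [normalPart]

lemma hasDerivAt_axisPoint (s : ℝ) : HasDerivAt (axisPoint (k := k)) (basisVec 0) s := by
  rw [show (axisPoint : ℝ → V (k + 1)) = fun s => s • basisVec 0 from funext axisPoint_eq_smul]
  simpa using (hasDerivAt_id s).smul_const (basisVec (0 : Fin (k + 1)))

lemma hasDerivAt_comp_axisPoint {f : V (k + 1) → ℝ} {s : ℝ}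
    (hf : DifferentiableAt ℝ f (axisPoint s)) :
    HasDerivAt (fun t => f (axisPoint t)) (pderiv 0 f (axisPoint s)) s :=
  hf.hasFDerivAt.comp_hasDerivAt s (hasDerivAt_axisPoint s)

lemma pderiv_zero_eq_zero {f : V (k + 1) → ℝ} {s : ℝ} (hf : DifferentiableAt ℝ f (axisPoint s))
    (h : ∀ t, f (axisPoint t) = 0) : pderiv 0 f (axisPoint s) = 0 := by
  rw [← (hasDerivAt_comp_axisPoint hf).deriv, funext h, deriv_const]

lemma multiDeriv_zero_eq_zero {f : V (k + 1) → ℝ} (hf : ∀ t, ContDiffAt ℝ ∞ f (axisPoint t))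
    (h : ∀ t, f (axisPoint t) = 0) (q : ℕ) (s : ℝ) :
    multiDeriv (fun _ : Fin q => (0 : Fin (k + 1))) f (axisPoint s) = 0 := by
  have haxis (t : ℝ) : axisPoint (k := k) t = (0 : V (k + 1)) + t • basisVec 0 := by
    rw [zero_add, axisPoint_eq_smul]
  simp only [haxis] at hf h ⊢
  induction q generalizing s with
  | zero => simpa [multiDeriv] using h s
  | succ q ih =>
    have hderiv := ContDiffAt.deriv_fderiv_add_smul (n := q)
      ((hf s).of_le (by exact_mod_cast le_top))
    rw [multiDeriv, ← hderiv]
    simp only [multiDeriv] at ih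
    rw [funext ih, deriv_const]

end Axis

section NormalExponential

variable {k : ℕ} {M : Type*} [TopologicalSpace M] [ChartedSpace (V (k + 1)) M]
  [IsManifold (𝓡 (k + 1)) ∞ M] {g : Metric (k + 1) M} {γ : ℝ → M}
  {e : Fin (k + 1) → ∀ t, TangentSpace (𝓡 (k + 1)) (γ t)} {s : ℝ}

/-- The vector `(0, v)`, normal to the axis. -/
noncomputable def normalVec (v : Fin k → ℝ) : V (k + 1) := WithLp.toLp 2 (Fin.cons 0 v)

@[simp] lemma normalVec_zero_apply (v : Fin k → ℝ) : normalVec v 0 = 0 := rfl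

@[simp] lemma normalVec_succ_apply (v : Fin k → ℝ) (m : Fin k) : normalVec v m.succ = v m := rfl

lemma normalVec_single (m : Fin k) : normalVec (Pi.single m 1) = basisVec m.succ := by
  ext i
  refine Fin.cases ?_ (fun l => ?_) i <;> simp [basisVec, Pi.single_apply]

/-- The geodesics normal to `γ` exist for all time, which is the part of completeness that makes
`normalExp` a genuine exponential map. -/
def IsNormallyComplete (g : Metric (k + 1) M) (γ : ℝ → M)
    (e : Fin (k + 1) → ∀ t, TangentSpace (𝓡 (k + 1)) (γ t)) : Prop :=
  ∀ (s : ℝ) (v : Fin k → ℝ), ∃ c : ℝ → M, IsGeodesicFrom g ⟨γ s, ∑ m, v m • e m.succ s⟩ c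

lemma normalExp_eq {x : V (k + 1)} {v : Fin k → ℝ} (h0 : x 0 = s) (hv : ∀ m, x m.succ = v m) :
    normalExp g γ e x = expMap g ⟨γ s, ∑ m, v m • e m.succ s⟩ := by
  subst h0
  simp only [normalExp, hv]

variable [T2Space M]

lemma normalExp_ray {v : Fin k → ℝ} {c : ℝ → M}
    (hc : IsGeodesicFrom g ⟨γ s, ∑ m, v m • e m.succ s⟩ c) (t : ℝ) :
    c t = normalExp g γ e (axisPoint s + t • normalVec v) := by
  rw [normalExp_eq (s := s) (v := fun m => t * v m) (by simp) (by simp), ← expMap_smul hc t,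
    Finset.smul_sum]
  simp only [smul_smul]

lemma normalExp_axisPoint (hg : IsNormallyComplete g γ e) (s : ℝ) :
    normalExp g γ e (axisPoint s) = γ s := by
  obtain ⟨c, hc⟩ := hg s 0
  have hray := normalExp_ray hc 0
  rw [zero_smul, add_zero] at hray
  exact hray.symm.trans (congrArg Bundle.TotalSpace.proj hc.2)

lemma tangentMap_normalExp_normalVec (hg : IsNormallyComplete g γ e)
    (hs : MDifferentiableAt (𝓡 (k + 1)) (𝓡 (k + 1)) (normalExp g γ e) (axisPoint s))
    (v : Fin k → ℝ) :
    tangentMap (𝓡 (k + 1)) (𝓡 (k + 1)) (normalExp g γ e) ⟨axisPoint s, normalVec v⟩ =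
      ⟨γ s, ∑ m, v m • e m.succ s⟩ := by
  obtain ⟨c, hc⟩ := hg s v
  have hline : HasDerivAt (fun t : ℝ => axisPoint s + t • normalVec v) (normalVec v) 0 := by
    simpa using ((hasDerivAt_id (0 : ℝ)).smul_const (normalVec v)).const_add (axisPoint s)
  rw [← tangentLift_comp hline (by simp) hs, ← hc.2]
  exact congrArg (fun c : ℝ → M => tangentLift (n := k + 1) c 0) (funext (normalExp_ray hc)).symm

lemma tangentMap_normalExp_succ (hg : IsNormallyComplete g γ e)
    (hs : MDifferentiableAt (𝓡 (k + 1)) (𝓡 (k + 1)) (normalExp g γ e) (axisPoint s))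
    (m : Fin k) :
    tangentMap (𝓡 (k + 1)) (𝓡 (k + 1)) (normalExp g γ e) ⟨axisPoint s, basisVec m.succ⟩ =
      ⟨γ s, e m.succ s⟩ := by
  rw [← normalVec_single, tangentMap_normalExp_normalVec hg hs, Finset.sum_eq_single m] <;>
    simp +contextual

lemma tangentMap_normalExp_zero (hg : IsNormallyComplete g γ e)
    (hs : MDifferentiableAt (𝓡 (k + 1)) (𝓡 (k + 1)) (normalExp g γ e) (axisPoint s)) :
    tangentMap (𝓡 (k + 1)) (𝓡 (k + 1)) (normalExp g γ e) ⟨axisPoint s, basisVec 0⟩ =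
      tangentLift γ s := by
  rw [← tangentLift_comp (hasDerivAt_axisPoint s) rfl hs]
  exact congrArg (fun c : ℝ → M => tangentLift (n := k + 1) c s)
    (funext fun t => normalExp_axisPoint hg t)

end NormalExponential

section FermiChristoffel

lemma eq_zero_of_forall_sum_mul_mul_eq_zero {ι : Type*} [Fintype ι] {B : ι → ι → ℝ}
    (hB : ∀ a b, B a b = B b a) (h : ∀ v : ι → ℝ, ∑ a, ∑ b, B a b * v a * v b = 0) (a b : ι) :
    B a b = 0 := by
  classical
  have hdiag (a : ι) : B a a = 0 := by simpa [Pi.single_apply] using h (Pi.single a 1)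
  have hpolar := h (Pi.single a 1 + Pi.single b 1)
  simp [Pi.single_apply, mul_add, Finset.sum_add_distrib, hdiag, hB b a] at hpolar
  linarith

variable {k : ℕ} {M : Type*} [TopologicalSpace M] [ChartedSpace (V (k + 1)) M]
  [IsManifold (𝓡 (k + 1)) ∞ M] {g : Metric (k + 1) M} {γ : ℝ → M}
  {e : Fin (k + 1) → ∀ t, TangentSpace (𝓡 (k + 1)) (γ t)}

lemma christoffel_fermiMetric_symm (i j l : Fin (k + 1)) :
    christoffel (fermiMetric g γ e) i j l = christoffel (fermiMetric g γ e) i l j :=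
  christoffel_symm (pullbackMetric_isSymm g _) i j l

variable [T2Space M]

lemma christoffel_fermiMetric_tangential (hg : IsNormallyComplete g γ e) (hγ : IsGeodesic g γ)
    {s : ℝ} (hs : IsLocalDiffeomorphAt (𝓡 (k + 1)) (𝓡 (k + 1)) ∞ (normalExp g γ e) (axisPoint s))
    (i : Fin (k + 1)) : christoffel (fermiMetric g γ e) i 0 0 (axisPoint s) = 0 := by
  have hequation := hγ.coordinate_equation (hasDerivAt_axisPoint s).continuousAt hs
    (fun t => (normalExp_axisPoint hg t).symm) i
  have hderiv (j : Fin (k + 1)) :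
      (deriv fun t => axisPoint (k := k) t j) = fun _ => (basisVec 0 : V (k + 1)) j := by
    funext t
    rw [deriv_apply (hasDerivAt_axisPoint t).differentiableAt, (hasDerivAt_axisPoint t).deriv]
  simpa [hderiv, basisVec, Pi.single_apply, fermiMetric] using hequation

lemma christoffel_fermiMetric_normal (hg : IsNormallyComplete g γ e) {s : ℝ}
    (hs : IsLocalDiffeomorphAt (𝓡 (k + 1)) (𝓡 (k + 1)) ∞ (normalExp g γ e) (axisPoint s))
    (i : Fin (k + 1)) (a b : Fin k) :
    christoffel (fermiMetric g γ e) i a.succ b.succ (axisPoint s) = 0 := by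
  have hsymm (a b : Fin k) : christoffel (fermiMetric g γ e) i a.succ b.succ (axisPoint s) =
      christoffel (fermiMetric g γ e) i b.succ a.succ (axisPoint s) := by
    rw [christoffel_fermiMetric_symm]
  refine eq_zero_of_forall_sum_mul_mul_eq_zero hsymm (fun v => ?_) a b
  obtain ⟨c, hc⟩ := hg s v
  have hline : ContinuousAt (fun t : ℝ => axisPoint s + t • normalVec v) 0 := by fun_prop
  have hzero : axisPoint s + (0 : ℝ) • normalVec v = axisPoint s := by simp
  have hdiffeo : IsLocalDiffeomorphAt (𝓡 (k + 1)) (𝓡 (k + 1)) ∞ (normalExp g γ e)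
      (axisPoint s + (0 : ℝ) • normalVec v) := by rwa [hzero]
  have hequation := hc.1.coordinate_equation hline hdiffeo (normalExp_ray hc) i
  have hderiv (j : Fin (k + 1)) :
      (deriv fun t : ℝ => (axisPoint s + t • normalVec v : V (k + 1)) j) =
        fun _ => normalVec v j := by
    funext t
    simp
  simpa [hderiv, Fin.sum_univ_succ, fermiMetric] using hequation

lemma christoffel_fermiMetric_mixed (hg : IsNormallyComplete g γ e)
    (hD : ∀ s, IsLocalDiffeomorphAt (𝓡 (k + 1)) (𝓡 (k + 1)) ∞ (normalExp g γ e) (axisPoint s))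
    {m : Fin k} (he : IsParallel g γ (e m.succ)) (s : ℝ) (i : Fin (k + 1)) :
    christoffel (fermiMetric g γ e) i 0 m.succ (axisPoint s) = 0 := by
  have hparallel := he.hasDerivAt_coordinate (t := s) (w := fun _ => basisVec m.succ)
    (hasDerivAt_axisPoint s).continuousAt hD
    (fun t => tangentMap_normalExp_succ hg ((hD t).mdifferentiableAt (by simp)) m) i
  have hderiv (j : Fin (k + 1)) :
      deriv (fun t => axisPoint (k := k) t j) s = (basisVec 0 : V (k + 1)) j := by
    rw [deriv_apply (hasDerivAt_axisPoint s).differentiableAt, (hasDerivAt_axisPoint s).deriv]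
  have hzero := hparallel.unique (hasDerivAt_const s _)
  simpa [hderiv, basisVec, Pi.single_apply, fermiMetric] using hzero

theorem christoffel_fermiMetric_axisPoint (hg : IsNormallyComplete g γ e) (hγ : IsGeodesic g γ)
    (he : ∀ m : Fin k, IsParallel g γ (e m.succ))
    (hD : ∀ s, IsLocalDiffeomorphAt (𝓡 (k + 1)) (𝓡 (k + 1)) ∞ (normalExp g γ e) (axisPoint s))
    (s : ℝ) (i j l : Fin (k + 1)) : christoffel (fermiMetric g γ e) i j l (axisPoint s) = 0 := by
  refine Fin.cases ?_ (fun a => ?_) j <;> refine Fin.cases ?_ (fun b => ?_) l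
  · exact christoffel_fermiMetric_tangential hg hγ (hD s) i
  · exact christoffel_fermiMetric_mixed hg hD (he b) s i
  · rw [christoffel_fermiMetric_symm]
    exact christoffel_fermiMetric_mixed hg hD (he a) s i
  · exact christoffel_fermiMetric_normal hg (hD s) i a b

theorem fermiMetric_axisPoint (hg : IsNormallyComplete g γ e) (hγ : IsGeodesic g γ)
    (he : IsFermiFrame g γ e)
    (hD : ∀ s, IsLocalDiffeomorphAt (𝓡 (k + 1)) (𝓡 (k + 1)) ∞ (normalExp g γ e) (axisPoint s))
    (s : ℝ) : fermiMetric g γ e (axisPoint s) = 1 := by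
  have hframe (i : Fin (k + 1)) : tangentMap (𝓡 (k + 1)) (𝓡 (k + 1)) (normalExp g γ e)
      ⟨axisPoint 0, basisVec i⟩ = ⟨γ 0, e i 0⟩ := by
    have h0 := (hD 0).mdifferentiableAt (n := ∞) (by simp)
    refine Fin.cases ?_ (fun m => tangentMap_normalExp_succ hg h0 m) i
    rw [tangentMap_normalExp_zero hg h0, he.first]
    rfl
  ext i j
  have hderiv (t : ℝ) : HasDerivAt (fun r => fermiMetric g γ e (axisPoint r) i j) 0 t := by
    have h := hasDerivAt_comp_axisPoint (f := fun z => fermiMetric g γ e z i j)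
      ((contDiffAt_pullbackMetric_of_isLocalDiffeomorphAt g (hD t) i j).differentiableAt (by simp))
    rwa [pderiv_metric_eq_zero (G := fermiMetric g γ e) (pullbackMetric_isSymm g _)
      (det_pullbackMetric_ne_zero_of_isLocalDiffeomorphAt g (hD t))
      (christoffel_fermiMetric_axisPoint hg hγ (fun m => he.parallel m.succ) hD t)] at h
  rw [is_const_of_deriv_eq_zero (fun t => (hderiv t).differentiableAt)
    (fun t => (hderiv t).deriv) s 0, Matrix.one_apply, ← he.orthonormal i j]
  exact pullbackMetric_apply_of_tangentMap_eq (hframe i) (hframe j)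

end FermiChristoffel

section NormalCoordinates

variable {k : ℕ}

/-- The tube `{x : |x⃗| < r}` around the axis, for `r ∈ [0, ∞]`; the Fermi domain is the tube whose
radius is the focal radius. -/
def normalTube (k : ℕ) (r : ENNReal) : Set (V (k + 1)) := {x | ‖normalPart x‖ₑ < r}

lemma isOpen_normalTube (r : ENNReal) : IsOpen (normalTube k r) :=
  isOpen_lt (continuous_enorm.comp (by unfold normalPart; fun_prop)) continuous_const

lemma axisPoint_mem_normalTube {r : ENNReal} (hr : 0 < r) (s : ℝ) :
    axisPoint s ∈ normalTube k r := by
  simpa [normalTube] using hr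

lemma axisPoint_add_smul_mem_normalTube {r : ENNReal} {u : V (k + 1)} (hu : u ∈ normalTube k r)
    (s : ℝ) {t : ℝ} (ht : t ∈ Set.Icc (0 : ℝ) 1) : axisPoint s + t • u ∈ normalTube k r := by
  have hpart : normalPart (axisPoint s + t • u) = t • normalPart u := by
    ext m
    simp [normalPart]
  have hnorm : ‖t‖ₑ ≤ 1 := by
    rw [Real.enorm_of_nonneg ht.1]
    exact ENNReal.ofReal_le_one.2 ht.2
  rw [normalTube, Set.mem_ofPred_eq, hpart, enorm_smul]
  exact (mul_le_of_le_one_left' hnorm).trans_lt hu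

lemma axisPoint_add_mem_normalTube {r : ENNReal} {u : V (k + 1)} (hu : u ∈ normalTube k r)
    (s : ℝ) : axisPoint s + u ∈ normalTube k r := by
  simpa using axisPoint_add_smul_mem_normalTube hu s (Set.right_mem_Icc.2 zero_le_one)

/-- `G` is a metric on the tube of radius `r` for which the coordinates are normal along the axis:
there it is the identity matrix to first order. -/
structure IsNormalAlongAxis (G : V (k + 1) → Matrix (Fin (k + 1)) (Fin (k + 1)) ℝ)
    (r : ENNReal) : Prop where
  radius_pos : 0 < r
  isSymm : ∀ x, (G x).IsSymm
  contDiffAt : ∀ x ∈ normalTube k r, ∀ i j, ContDiffAt ℝ ∞ (fun z => G z i j) x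
  det_ne_zero : ∀ x ∈ normalTube k r, (G x).det ≠ 0
  metric_axis : ∀ s, G (axisPoint s) = 1
  christoffel_axis : ∀ i j l s, christoffel G i j l (axisPoint s) = 0

namespace IsNormalAlongAxis

variable {G : V (k + 1) → Matrix (Fin (k + 1)) (Fin (k + 1)) ℝ} {r : ENNReal}

lemma axisPoint_mem (hG : IsNormalAlongAxis G r) (s : ℝ) : axisPoint s ∈ normalTube k r :=
  axisPoint_mem_normalTube hG.radius_pos s

lemma contDiffAt_christoffel (hG : IsNormalAlongAxis G r) {x : V (k + 1)}
    (hx : x ∈ normalTube k r) (i j l : Fin (k + 1)) : ContDiffAt ℝ ∞ (christoffel G i j l) x :=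
  FermiWaveMap.contDiffAt_christoffel (hG.contDiffAt x hx) (hG.det_ne_zero x hx) i j l

lemma multiDeriv_christoffel_axis (hG : IsNormalAlongAxis G r) (q : ℕ) (i j l : Fin (k + 1))
    (s : ℝ) :
    multiDeriv (fun _ : Fin q => (0 : Fin (k + 1))) (christoffel G i j l) (axisPoint s) = 0 :=
  multiDeriv_zero_eq_zero (fun t => hG.contDiffAt_christoffel (hG.axisPoint_mem t) i j l)
    (hG.christoffel_axis i j l) q s

lemma pderiv_metric_axis (hG : IsNormalAlongAxis G r) (a b c : Fin (k + 1)) (s : ℝ) :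
    pderiv a (fun z => G z b c) (axisPoint s) = 0 :=
  pderiv_metric_eq_zero hG.isSymm (hG.det_ne_zero _ (hG.axisPoint_mem s))
    (fun i j l => hG.christoffel_axis i j l s) a b c

lemma pderiv_christoffel_zero_zero_zero_axis (hG : IsNormalAlongAxis G r) (a : Fin (k + 1))
    (s : ℝ) : pderiv a (christoffel G 0 0 0) (axisPoint s) = 0 := by
  have hsmooth := hG.contDiffAt _ (hG.axisPoint_mem s) 0 0
  have hsmooth2 : ContDiffAt ℝ 2 (fun z => G z 0 0) (axisPoint s) :=
    hsmooth.of_le ENat.LEInfty.out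
  have hfirst : christoffelFirstKind G 0 0 0 = fun z => 1 / 2 * pderiv 0 (fun w => G w 0 0) z := by
    funext z
    simp [christoffelFirstKind]
  have hmixed : pderiv a (pderiv 0 fun z => G z 0 0) (axisPoint s) = 0 := by
    rw [pderiv_comm hsmooth2]
    exact pderiv_zero_eq_zero ((contDiffAt_pderiv hsmooth2 a (m := 1)
      (by norm_num)).differentiableAt (by simp)) (fun t => hG.pderiv_metric_axis a 0 0 t)
  rw [pderiv_christoffel_eq_pderiv_christoffelFirstKind
      (fun i j => (hG.contDiffAt _ (hG.axisPoint_mem s) i j).of_le ENat.LEInfty.out)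
      (hG.metric_axis s) (fun i => hG.christoffel_axis i 0 0 s), hfirst,
    pderiv_const_mul ((contDiffAt_pderiv hsmooth2 0 (m := 1)
      (by norm_num)).differentiableAt (by simp)), hmixed, mul_zero]

lemma riemann_axis (hG : IsNormalAlongAxis G r) (m i j : Fin (k + 1)) (s : ℝ) :
    riemann G m 0 j i (axisPoint s) = pderiv m (christoffel G i j 0) (axisPoint s) := by
  have hzero (p : Fin (k + 1)) : pderiv 0 (christoffel G p m j) (axisPoint s) = 0 :=
    pderiv_zero_eq_zero ((hG.contDiffAt_christoffel (hG.axisPoint_mem s) _ _ _).differentiableAt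
      (by simp)) (hG.christoffel_axis _ _ _)
  simp only [riemann, hG.metric_axis, hG.christoffel_axis, hzero, Matrix.one_apply]
  simp [christoffel_symm hG.isSymm i 0 j]

end IsNormalAlongAxis

end NormalCoordinates

section FermiMetric

variable {k : ℕ} {M : Type*} [TopologicalSpace M] [ChartedSpace (V (k + 1)) M]
  [IsManifold (𝓡 (k + 1)) ∞ M] {g : Metric (k + 1) M} {γ : ℝ → M}
  {e : Fin (k + 1) → ∀ t, TangentSpace (𝓡 (k + 1)) (γ t)}

lemma isLocalDiffeomorphAt_normalExp {x : V (k + 1)}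
    (hx : x ∈ normalTube k (focalRadius g γ e)) :
    IsLocalDiffeomorphAt (𝓡 (k + 1)) (𝓡 (k + 1)) ∞ (normalExp g γ e) x := by
  obtain ⟨r, hr, hxr⟩ := lt_sSup_iff.1 (show ‖normalPart x‖ₑ < focalRadius g γ e from hx)
  exact hr x hxr

theorem isNormalAlongAxis_fermiMetric [T2Space M] (hg : IsNormallyComplete g γ e)
    (hγ : IsGeodesic g γ) (he : IsFermiFrame g γ e) (hr : 0 < focalRadius g γ e) :
    IsNormalAlongAxis (fermiMetric g γ e) (focalRadius g γ e) where
  radius_pos := hr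
  isSymm := pullbackMetric_isSymm g _
  contDiffAt _ hx :=
    contDiffAt_pullbackMetric_of_isLocalDiffeomorphAt g (isLocalDiffeomorphAt_normalExp hx)
  det_ne_zero _ hx :=
    det_pullbackMetric_ne_zero_of_isLocalDiffeomorphAt g (isLocalDiffeomorphAt_normalExp hx)
  metric_axis := fermiMetric_axisPoint hg hγ he fun s =>
    isLocalDiffeomorphAt_normalExp (axisPoint_mem_normalTube hr s)
  christoffel_axis i j l s := christoffel_fermiMetric_axisPoint hg hγ
    (fun m => he.parallel m.succ)
    (fun s => isLocalDiffeomorphAt_normalExp (axisPoint_mem_normalTube hr s)) s i j l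

end FermiMetric

section TaylorRemainder

variable {E : Type*} [NormedAddCommGroup E] [NormedSpace ℝ E]

/-- The error `F (x + u) - ∑_{q ≤ N} D^q F(x)[u, …, u] / q!` of the Taylor polynomial of degree
`N`. -/
noncomputable def taylorRemainder (N : ℕ) (F : E → ℝ) (x u : E) : ℝ :=
  F (x + u) - ∑ q ∈ Finset.range (N + 1), (q.factorial : ℝ)⁻¹ * iteratedFDeriv ℝ q F x fun _ => u

lemma abs_taylorRemainder_le {N : ℕ} {F : E → ℝ} {x u : E} {K : ℝ}
    (hF : ∀ t ∈ Set.Icc (0 : ℝ) 1, ContDiffAt ℝ (N + 1) F (x + t • u))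
    (hK : ∀ t ∈ Set.Icc (0 : ℝ) 1, ‖iteratedFDeriv ℝ (N + 1) F (x + t • u)‖ ≤ K) :
    |taylorRemainder N F x u| ≤ K * ‖u‖ ^ (N + 1) := by
  have hintegral : taylorRemainder N F x u = (N.factorial : ℝ)⁻¹ * ∫ t in (0 : ℝ)..1,
      (1 - t) ^ N * iteratedFDeriv ℝ (N + 1) F (x + t • u) fun _ => u := by
    simp only [taylorRemainder, map_add_eq_sum_add_integral_iteratedFDeriv hF, smul_eq_mul,
      add_sub_cancel_left]
  have hintegrand (t : ℝ) (ht : t ∈ Set.uIoc (0 : ℝ) 1) :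
      ‖(1 - t) ^ N * iteratedFDeriv ℝ (N + 1) F (x + t • u) fun _ => u‖ ≤ K * ‖u‖ ^ (N + 1) := by
    rw [Set.uIoc_of_le zero_le_one] at ht
    have hweight : ‖(1 - t) ^ N‖ ≤ 1 := by
      rw [norm_pow]
      exact pow_le_one₀ (norm_nonneg _) (abs_le.2 ⟨by linarith [ht.2], by linarith [ht.1]⟩)
    rw [norm_mul]
    refine (mul_le_of_le_one_left (norm_nonneg _) hweight).trans ?_
    exact (ContinuousMultilinearMap.le_of_opNorm_le (hK t ⟨ht.1.le, ht.2⟩) _).trans_eq (by simp)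
  have hnorm := intervalIntegral.norm_integral_le_of_norm_le_const hintegrand
  rw [hintegral, abs_mul, abs_of_nonneg (by positivity)]
  refine (mul_le_of_le_one_left (abs_nonneg _) ?_).trans (by simpa using hnorm)
  exact inv_le_one_of_one_le₀ (by exact_mod_cast N.factorial_pos)

end TaylorRemainder

section Coordinates

variable {n : ℕ}

lemma iteratedFDeriv_eq_sum_multiDeriv {q : ℕ} (F : V n → ℝ) (x : V n) (v : Fin q → V n) :
    iteratedFDeriv ℝ q F x v = ∑ A : Fin q → Fin n, multiDeriv A F x * ∏ a, v a (A a) := by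
  have hv : v = fun a => ∑ i, v a i • basisVec i := funext fun a => (sum_smul_basisVec (v a)).symm
  conv_lhs => rw [hv, ContinuousMultilinearMap.map_sum]
  refine Finset.sum_congr rfl fun A _ => ?_
  rw [ContinuousMultilinearMap.map_smul_univ, smul_eq_mul, mul_comm, multiDeriv]

lemma norm_iteratedFDeriv_le_of_multiDeriv {q : ℕ} {F : V n → ℝ} {x : V n} {K : ℝ} (hK₀ : 0 ≤ K)
    (hK : ∀ A : Fin q → Fin n, |multiDeriv A F x| ≤ K) :
    ‖iteratedFDeriv ℝ q F x‖ ≤ (n : ℝ) ^ q * K := by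
  refine ContinuousMultilinearMap.opNorm_le_bound (by positivity) fun v => ?_
  have hterm (A : Fin q → Fin n) : |multiDeriv A F x * ∏ a, v a (A a)| ≤ K * ∏ a, ‖v a‖ := by
    rw [abs_mul, Finset.abs_prod]
    gcongr with a
    · exact hK A
    · exact PiLp.norm_apply_le (v a) (A a)
  rw [iteratedFDeriv_eq_sum_multiDeriv]
  calc |∑ A : Fin q → Fin n, multiDeriv A F x * ∏ a, v a (A a)|
      ≤ ∑ _A : Fin q → Fin n, K * ∏ a, ‖v a‖ :=
        (Finset.abs_sum_le_sum_abs _ _).trans (Finset.sum_le_sum fun A _ => hterm A)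
    _ = (n : ℝ) ^ q * K * ∏ a, ‖v a‖ := by simp [mul_assoc]

lemma contDiffAt_multiDeriv {q : ℕ} {F : V n → ℝ} {x : V n} (hF : ContDiffAt ℝ ∞ F x)
    (A : Fin q → Fin n) : ContDiffAt ℝ ∞ (multiDeriv A F) x :=
  (ContinuousMultilinearMap.apply ℝ (fun _ : Fin q => V n) ℝ
    fun a => basisVec (A a)).contDiff.contDiffAt.comp x
      (hF.iteratedFDeriv_right (m := ∞) (i := q) (by exact_mod_cast le_top))

lemma contDiffAt_taylorRemainder {F : V n → ℝ} {z : V n × V n} (hx : ContDiffAt ℝ ∞ F z.1)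
    (hxu : ContDiffAt ℝ ∞ F (z.1 + z.2)) (N : ℕ) :
    ContDiffAt ℝ ∞ (fun w : V n × V n => taylorRemainder N F w.1 w.2) z := by
  simp only [taylorRemainder, iteratedFDeriv_eq_sum_multiDeriv]
  refine (hxu.comp z (contDiffAt_fst.add contDiffAt_snd)).sub
    (ContDiffAt.sum fun q _ => contDiffAt_const.mul (ContDiffAt.sum fun A _ => ?_))
  exact ((contDiffAt_multiDeriv hx A).comp z contDiffAt_fst).mul
    (contDiffAt_prod fun a _ => by fun_prop)

end Coordinates

section TaylorAlongAxis

variable {k : ℕ} {F : V (k + 1) → ℝ} (hF : ∀ t, ContDiffAt ℝ ∞ F (axisPoint t))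
  (h : ∀ t, F (axisPoint t) = 0) (s : ℝ) (u : V (k + 1))

include hF h

lemma inv_factorial_mul_iteratedFDeriv_axisPoint (q : ℕ) :
    (q.factorial : ℝ)⁻¹ * iteratedFDeriv ℝ q F (axisPoint s) (fun _ => u) =
      mixedTaylor q F s u := by
  rw [iteratedFDeriv_eq_sum_multiDeriv, mixedTaylor, Finset.mul_sum, Finset.sum_filter_of_ne]
  · exact Finset.sum_congr rfl fun A _ => (mul_assoc _ _ _).symm
  · rintro A - hA rfl
    exact hA (by rw [multiDeriv_zero_eq_zero hF h, mul_zero, zero_mul])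

lemma fderiv_axisPoint_eq_sum :
    fderiv ℝ F (axisPoint s) u = ∑ m : Fin k, pderiv m.succ F (axisPoint s) * u m.succ := by
  have hzero := pderiv_zero_eq_zero ((hF s).differentiableAt (by simp)) h
  conv_lhs => rw [← sum_smul_basisVec u, map_sum, Fin.sum_univ_succ]
  simp only [pderiv, map_smul, smul_eq_mul] at hzero ⊢
  simp only [hzero, zero_mul, zero_add, mul_comm]

lemma taylor_one_axisPoint :
    F (axisPoint s + u) = ∑ m : Fin k, pderiv m.succ F (axisPoint s) * u m.succ
      + taylorRemainder 1 F (axisPoint s) u := by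
  simp [taylorRemainder, Finset.sum_range_succ, h, fderiv_axisPoint_eq_sum hF h]

lemma taylor_two_axisPoint :
    F (axisPoint s + u) = ∑ m : Fin k, pderiv m.succ F (axisPoint s) * u m.succ
      + mixedTaylor 2 F s u + taylorRemainder 2 F (axisPoint s) u := by
  rw [← inv_factorial_mul_iteratedFDeriv_axisPoint hF h, taylor_one_axisPoint hF h]
  simp only [taylorRemainder, Finset.sum_range_succ]
  ring

lemma taylor_three_axisPoint :
    F (axisPoint s + u) = ∑ m : Fin k, pderiv m.succ F (axisPoint s) * u m.succ
      + mixedTaylor 2 F s u + mixedTaylor 3 F s u + taylorRemainder 3 F (axisPoint s) u := by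
  rw [← inv_factorial_mul_iteratedFDeriv_axisPoint hF h (q := 3), taylor_two_axisPoint hF h]
  simp only [taylorRemainder, Finset.sum_range_succ]
  ring

end TaylorAlongAxis

section Minkowski

variable {d : ℕ}

lemma mink_smul_add_smul_add (x y : ℝ) (c a b : Fin (d + 1) → ℝ) :
    mink (x • c + a) (y • c + b) =
      x * y * mink c c + x * mink b c + y * mink a c + mink a b := by
  have hterm (μ : Fin d) : (x * c μ.succ + a μ.succ) * (y * c μ.succ + b μ.succ) =
      x * y * (c μ.succ * c μ.succ) + x * (b μ.succ * c μ.succ) + y * (a μ.succ * c μ.succ)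
        + a μ.succ * b μ.succ := by ring
  simp only [mink, Pi.add_apply, Pi.smul_apply, smul_eq_mul, hterm, Finset.sum_add_distrib,
    ← Finset.mul_sum]
  ring

lemma sum_sum_mul_mink_single_smul_add {ι : Type*} [Fintype ι] [DecidableEq ι] {a : ι → ι → ℝ}
    (ha : ∀ j l, a j l = a l j) (o : ι) (c : Fin (d + 1) → ℝ) (p : ι → Fin (d + 1) → ℝ) :
    ∑ j, ∑ l, a j l * mink ((Pi.single o 1 : ι → ℝ) j • c + p j)
        ((Pi.single o 1 : ι → ℝ) l • c + p l) =
      a o o * mink c c + 2 * ∑ j, a j o * mink (p j) c + ∑ j, ∑ l, a j l * mink (p j) (p l) := by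
  simp only [mink_smul_add_smul_add, mul_add, Finset.sum_add_distrib]
  simp [Pi.single_apply, ha o]
  ring

lemma pderiv_const_mul_linear_add {n : ℕ} {f : V n → ℝ} (L : V n →ₗ[ℝ] ℝ) (c : ℝ) {y : V n}
    (hf : DifferentiableAt ℝ f y) (μ : Fin n) :
    pderiv μ (fun z => c * L z + f z) y = c * L (basisVec μ) + pderiv μ f y := by
  have hsum : HasFDerivAt (fun z => c * L z + f z)
      (c • LinearMap.toContinuousLinearMap L + fderiv ℝ f y) y :=
    ((LinearMap.toContinuousLinearMap L).hasFDerivAt.const_mul c).add hf.hasFDerivAt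
  rw [pderiv, hsum.fderiv]
  simp [pderiv]

end Minkowski

section PerturbedMap

variable {k d : ℕ} {ell : V (d + 1) →ₗ[ℝ] ℝ} {u : V (d + 1) → V (k + 1)} {y : V (d + 1)}

lemma perturbedMap_apply (ell : V (d + 1) →ₗ[ℝ] ℝ) (u : V (d + 1) → V (k + 1)) (i : Fin (k + 1)) :
    (fun z => perturbedMap ell u z i) =
      fun z => (Pi.single 0 1 : Fin (k + 1) → ℝ) i * ell z + u z i := by
  funext z
  simp [perturbedMap, axisPoint, Pi.single_apply]

lemma pderiv_perturbedMap (hu : DifferentiableAt ℝ u y) (i : Fin (k + 1)) (μ : Fin (d + 1)) :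
    pderiv μ (fun z => perturbedMap ell u z i) y =
      (Pi.single 0 1 : Fin (k + 1) → ℝ) i * ell (basisVec μ) + pderiv μ (fun z => u z i) y := by
  rw [perturbedMap_apply, pderiv_const_mul_linear_add _ _ (by fun_prop)]

lemma grad_perturbedMap {dl : Fin (d + 1) → ℝ} (hdl : ∀ μ, dl μ = ell (basisVec μ))
    (hu : DifferentiableAt ℝ u y) (i : Fin (k + 1)) :
    grad (fun z => perturbedMap ell u z i) y =
      (Pi.single 0 1 : Fin (k + 1) → ℝ) i • dl + jet u y i := by
  funext μ
  rw [grad, pderiv_perturbedMap hu, ← hdl]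
  rfl

lemma box_perturbedMap (hu : ContDiffAt ℝ 2 u y) (i : Fin (k + 1)) :
    box (fun z => perturbedMap ell u z i) y = box (fun z => u z i) y := by
  have hsecond (μ : Fin (d + 1)) : pderiv μ (pderiv μ fun z => perturbedMap ell u z i) y =
      pderiv μ (pderiv μ fun z => u z i) y := by
    have hfirst : (pderiv μ fun z => perturbedMap ell u z i) =ᶠ[𝓝 y] fun z =>
        (Pi.single 0 1 : Fin (k + 1) → ℝ) i * ell (basisVec μ) + pderiv μ (fun z => u z i) z :=
      (hu.eventually (by simp)).mono fun z hz =>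
        pderiv_perturbedMap (hz.differentiableAt (by simp)) i μ
    rw [pderiv_congr hfirst, pderiv, fderiv_const_add, pderiv]
  simp only [box, hsecond]

end PerturbedMap

section Expansion

variable {k d : ℕ} {G : V (k + 1) → Matrix (Fin (k + 1)) (Fin (k + 1)) ℝ} {r : ENNReal}

/-- The higher order part `hⁱ(s, u, p)`: in `Γⁱ_{jl}(s + u¹, u⃗) 𝔪(dφʲ, dφˡ)` the coefficient of a
product with `m` factors `p = ∂u` is replaced by its Taylor remainder of degree `3 - m`, so that
`u` and `p` occur with total degree four. -/
noncomputable def higherOrderPart (G : V (k + 1) → Matrix (Fin (k + 1)) (Fin (k + 1)) ℝ)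
    (dl : Fin (d + 1) → ℝ) (i : Fin (k + 1))
    (z : ℝ × V (k + 1) × (Fin (k + 1) → Fin (d + 1) → ℝ)) : ℝ :=
  -(taylorRemainder 3 (christoffel G i 0 0) (axisPoint z.1) z.2.1 * mink dl dl
    + 2 * ∑ j, taylorRemainder 2 (christoffel G i j 0) (axisPoint z.1) z.2.1 * mink (z.2.2 j) dl
    + ∑ j, ∑ l, taylorRemainder 1 (christoffel G i j l) (axisPoint z.1) z.2.1
        * mink (z.2.2 j) (z.2.2 l))

namespace IsNormalAlongAxis

lemma sum_christoffel_mul_mink_eq (hG : IsNormalAlongAxis G r) (dl : Fin (d + 1) → ℝ)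
    (i : Fin (k + 1)) (s : ℝ) (v : V (k + 1)) (p : Fin (k + 1) → Fin (d + 1) → ℝ) :
    christoffel G i 0 0 (axisPoint s + v) * mink dl dl
      + 2 * ∑ j, christoffel G i j 0 (axisPoint s + v) * mink (p j) dl
      + ∑ j, ∑ l, christoffel G i j l (axisPoint s + v) * mink (p j) (p l) =
    ∑ m : Fin k, riemann G m.succ 0 0 i (axisPoint s) * v m.succ * mink dl dl
      - nonlinearity G dl i s v p - higherOrderPart G dl i (s, v, p) := by
  have hsmooth (j l : Fin (k + 1)) (t : ℝ) := hG.contDiffAt_christoffel (hG.axisPoint_mem t) i j l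
  have hlinear : ∑ j, (∑ m : Fin k, pderiv m.succ (christoffel G i j 0) (axisPoint s) * v m.succ)
      * mink (p j) dl = ∑ m : Fin k, ∑ j,
        pderiv m.succ (christoffel G i j 0) (axisPoint s) * v m.succ * mink (p j) dl := by
    simp only [Finset.sum_mul]
    exact Finset.sum_comm
  have hquadratic : ∑ j, ∑ l, (∑ m : Fin k,
      pderiv m.succ (christoffel G i j l) (axisPoint s) * v m.succ) * mink (p j) (p l) =
      ∑ m : Fin k, ∑ j, ∑ l,
        pderiv m.succ (christoffel G i j l) (axisPoint s) * v m.succ * mink (p j) (p l) := by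
    simp only [Finset.sum_mul]
    exact (Finset.sum_congr rfl fun j _ => Finset.sum_comm).trans Finset.sum_comm
  rw [taylor_three_axisPoint (hsmooth 0 0) (hG.christoffel_axis i 0 0)]
  simp only [taylor_two_axisPoint (hsmooth _ 0) (hG.christoffel_axis i _ 0),
    taylor_one_axisPoint (hsmooth _ _) (hG.christoffel_axis i _ _), add_mul,
    Finset.sum_add_distrib, hlinear, hquadratic, nonlinearity, higherOrderPart, hG.riemann_axis,
    ← Finset.sum_mul]
  ring

theorem waveMapOp_perturbedMap (hG : IsNormalAlongAxis G r) {ell : V (d + 1) →ₗ[ℝ] ℝ}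
    {dl : Fin (d + 1) → ℝ} (hdl : ∀ μ, dl μ = ell (basisVec μ)) {u : V (d + 1) → V (k + 1)}
    {y : V (d + 1)} (hu : ContDiffAt ℝ 2 u y) (i : Fin (k + 1)) :
    waveMapOp G (perturbedMap ell u) i y = box (fun z => u z i) y
      + ∑ m : Fin k, riemann G m.succ 0 0 i (axisPoint (ell y)) * u y m.succ * mink dl dl
      - nonlinearity G dl i (ell y) (u y) (jet u y)
      - higherOrderPart G dl i (ell y, u y, jet u y) := by
  rw [waveMapOp, box_perturbedMap hu]
  simp only [grad_perturbedMap hdl (hu.differentiableAt (by simp))]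
  rw [sum_sum_mul_mink_single_smul_add
      (fun j l => by rw [christoffel_symm hG.isSymm]), perturbedMap,
    hG.sum_christoffel_mul_mink_eq]
  ring

end IsNormalAlongAxis

end Expansion

section Smoothness

variable {k d : ℕ} {G : V (k + 1) → Matrix (Fin (k + 1)) (Fin (k + 1)) ℝ} {r : ENNReal}

lemma contDiff_axisPoint : ContDiff ℝ ∞ (axisPoint (k := k)) := by
  rw [show (axisPoint : ℝ → V (k + 1)) = fun s => s • basisVec 0 from funext axisPoint_eq_smul]
  fun_prop

lemma contDiff_mink : ContDiff ℝ ∞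
    (fun w : (Fin (d + 1) → ℝ) × (Fin (d + 1) → ℝ) => mink w.1 w.2) := by
  unfold mink
  fun_prop

lemma contDiffOn_higherOrderPart (hG : IsNormalAlongAxis G r) (dl : Fin (d + 1) → ℝ)
    (i : Fin (k + 1)) : ContDiffOn ℝ ∞ (higherOrderPart G dl i) (jetDomain d (normalTube k r)) := by
  refine fun z hz => ContDiffAt.contDiffWithinAt ?_
  have hremainder (N : ℕ) (j l : Fin (k + 1)) :
      ContDiffAt ℝ ∞ (fun w : ℝ × V (k + 1) × (Fin (k + 1) → Fin (d + 1) → ℝ) =>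
        taylorRemainder N (christoffel G i j l) (axisPoint w.1) w.2.1) z :=
    ContDiffAt.comp z (contDiffAt_taylorRemainder (z := (axisPoint z.1, z.2.1))
      (hG.contDiffAt_christoffel (hG.axisPoint_mem _) i j l)
      (hG.contDiffAt_christoffel (axisPoint_add_mem_normalTube hz _) i j l) N)
      (f := fun w => (axisPoint w.1, w.2.1))
      ((contDiff_axisPoint.contDiffAt.comp z contDiffAt_fst).prodMk contDiffAt_snd.fst)
  have hjet (j : Fin (k + 1)) : ContDiffAt ℝ ∞
      (fun w : ℝ × V (k + 1) × (Fin (k + 1) → Fin (d + 1) → ℝ) => w.2.2 j) z := by fun_prop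
  unfold higherOrderPart
  exact ((((hremainder 3 0 0).mul contDiffAt_const).add (contDiffAt_const.mul
    (ContDiffAt.sum fun j _ => (hremainder 2 j 0).mul
      (contDiff_mink.contDiffAt.comp z ((hjet j).prodMk contDiffAt_const))))).add
    (ContDiffAt.sum fun j _ => ContDiffAt.sum fun l _ => (hremainder 1 j l).mul
      (contDiff_mink.contDiffAt.comp z ((hjet j).prodMk (hjet l))))).neg

end Smoothness

section MinkowskiBounds

variable {d : ℕ}

lemma abs_mink_le (a b : Fin (d + 1) → ℝ) : |mink a b| ≤ (d + 1) * (‖a‖ * ‖b‖) := by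
  have hterm (μ : Fin (d + 1)) : |a μ * b μ| ≤ ‖a‖ * ‖b‖ := by
    rw [abs_mul]
    exact mul_le_mul (norm_le_pi_norm a μ) (norm_le_pi_norm b μ) (abs_nonneg _) (norm_nonneg _)
  calc |mink a b| ≤ |a 0 * b 0| + ∑ μ : Fin d, |a μ.succ * b μ.succ| := by
        rw [mink, ← abs_neg (a 0 * b 0)]
        exact (abs_add_le _ _).trans (add_le_add_right (Finset.abs_sum_le_sum_abs _ _) _)
    _ = ∑ μ, |a μ * b μ| := (Fin.sum_univ_succ fun μ => |a μ * b μ|).symm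
    _ ≤ ∑ _μ : Fin (d + 1), ‖a‖ * ‖b‖ := Finset.sum_le_sum fun μ _ => hterm μ
    _ = (d + 1) * (‖a‖ * ‖b‖) := by simp

lemma abs_sum_mul_mink_le {ι : Type*} [Fintype ι] {c : ι → ℝ} {a b : ι → Fin (d + 1) → ℝ}
    {B P Q : ℝ} (hc : ∀ j, |c j| ≤ B) (ha : ∀ j, ‖a j‖ ≤ P) (hb : ∀ j, ‖b j‖ ≤ Q) :
    |∑ j, c j * mink (a j) (b j)| ≤ Fintype.card ι * (B * ((d + 1) * (P * Q))) := by
  have hterm (j : ι) : |c j * mink (a j) (b j)| ≤ B * ((d + 1) * (P * Q)) := by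
    have hB := (abs_nonneg _).trans (hc j)
    have hP := (norm_nonneg _).trans (ha j)
    rw [abs_mul]
    refine mul_le_mul (hc j) ((abs_mink_le _ _).trans ?_) (abs_nonneg _) hB
    gcongr
    exacts [ha j, hb j]
  calc |∑ j, c j * mink (a j) (b j)| ≤ ∑ _j : ι, B * ((d + 1) * (P * Q)) :=
        (Finset.abs_sum_le_sum_abs _ _).trans (Finset.sum_le_sum fun j _ => hterm j)
    _ = Fintype.card ι * (B * ((d + 1) * (P * Q))) := by simp

end MinkowskiBounds

section HigherOrder

lemma pow_mul_pow_le_pow_add_pow {a b : ℝ} (ha : 0 ≤ a) (hb : 0 ≤ b) (m n : ℕ) :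
    a ^ m * b ^ n ≤ a ^ (m + n) + b ^ (m + n) := by
  rcases le_total a b with h | h
  · calc a ^ m * b ^ n ≤ b ^ m * b ^ n := by gcongr
      _ ≤ a ^ (m + n) + b ^ (m + n) := by
        rw [← pow_add]
        exact le_add_of_nonneg_left (by positivity)
  · calc a ^ m * b ^ n ≤ a ^ m * a ^ n := by gcongr
      _ ≤ a ^ (m + n) + b ^ (m + n) := by
        rw [← pow_add]
        exact le_add_of_nonneg_right (by positivity)

variable {k d : ℕ}

/-- The sum of the norms of the derivatives of orders `2`, `3`, `4` of the Christoffel symbols,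
which controls all the Taylor remainders in `higherOrderPart`. -/
noncomputable def derivSum (G : V (k + 1) → Matrix (Fin (k + 1)) (Fin (k + 1)) ℝ)
    (x : V (k + 1)) : ℝ :=
  ∑ a : Fin (k + 1) × Fin (k + 1) × Fin (k + 1), ∑ q ∈ Finset.Icc 2 4,
    ‖iteratedFDeriv ℝ q (christoffel G a.1 a.2.1 a.2.2) x‖

variable {G : V (k + 1) → Matrix (Fin (k + 1)) (Fin (k + 1)) ℝ} {r : ENNReal}

lemma norm_iteratedFDeriv_christoffel_le_derivSum {q : ℕ} (hq : q ∈ Finset.Icc 2 4)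
    (i j l : Fin (k + 1)) (x : V (k + 1)) :
    ‖iteratedFDeriv ℝ q (christoffel G i j l) x‖ ≤ derivSum G x := by
  let N (a : Fin (k + 1) × Fin (k + 1) × Fin (k + 1)) (q : ℕ) : ℝ :=
    ‖iteratedFDeriv ℝ q (christoffel G a.1 a.2.1 a.2.2) x‖
  have hN (a) (q : ℕ) : 0 ≤ N a q := norm_nonneg _
  calc N (i, j, l) q ≤ ∑ q ∈ Finset.Icc 2 4, N (i, j, l) q :=
        Finset.single_le_sum (fun q _ => hN (i, j, l) q) hq
    _ ≤ ∑ a, ∑ q ∈ Finset.Icc 2 4, N a q :=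
        Finset.single_le_sum (f := fun a => ∑ q ∈ Finset.Icc 2 4, N a q)
          (fun a _ => Finset.sum_nonneg fun q _ => hN a q) (Finset.mem_univ (i, j, l))

lemma derivSum_nonneg (x : V (k + 1)) : 0 ≤ derivSum G x :=
  Finset.sum_nonneg fun _ _ => Finset.sum_nonneg fun _ _ => norm_nonneg _

lemma derivSum_le_of_multiDeriv {K : ℝ} {x : V (k + 1)}
    (hK : ∀ q : ℕ, 2 ≤ q → q ≤ 4 → ∀ (A : Fin q → Fin (k + 1)) (i j l : Fin (k + 1)),
      |multiDeriv A (christoffel G i j l) x| ≤ K) :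
    derivSum G x ≤ ∑ _a : Fin (k + 1) × Fin (k + 1) × Fin (k + 1), ∑ q ∈ Finset.Icc 2 4,
      ((k + 1 : ℕ) : ℝ) ^ q * K :=
  Finset.sum_le_sum fun a _ => Finset.sum_le_sum fun q hq => by
    have hbound := hK q (Finset.mem_Icc.1 hq).1 (Finset.mem_Icc.1 hq).2
    exact norm_iteratedFDeriv_le_of_multiDeriv
      ((abs_nonneg _).trans (hbound (fun _ => 0) a.1 a.2.1 a.2.2))
      fun A => hbound A a.1 a.2.1 a.2.2

lemma continuousOn_derivSum (hG : IsNormalAlongAxis G r) :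
    ContinuousOn (derivSum G) (normalTube k r) :=
  continuousOn_finsetSum _ fun a _ => continuousOn_finsetSum _ fun q _ => ContinuousOn.norm
    fun _ hx => ((hG.contDiffAt_christoffel hx a.1 a.2.1 a.2.2).iteratedFDeriv_right (m := 0)
      (i := q) (by exact_mod_cast le_top)).continuousAt.continuousWithinAt

lemma abs_higherOrderPart_le (dl : Fin (d + 1) → ℝ) {s K : ℝ} {u : V (k + 1)}
    (hsmooth : ∀ t ∈ Set.Icc (0 : ℝ) 1, ∀ i j l,
      ContDiffAt ℝ ∞ (christoffel G i j l) (axisPoint s + t • u))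
    (hK : ∀ t ∈ Set.Icc (0 : ℝ) 1, derivSum G (axisPoint s + t • u) ≤ K)
    (i : Fin (k + 1)) (p : Fin (k + 1) → Fin (d + 1) → ℝ) :
    |higherOrderPart G dl i (s, u, p)| ≤
      (d + 1) * (‖dl‖ + (k + 1)) ^ 2 * K * (‖u‖ ^ 4 + ‖p‖ ^ 4) := by
  have hK₀ : 0 ≤ K := (derivSum_nonneg _).trans (hK 0 (by simp))
  have hR (N : ℕ) (hN : N + 1 ∈ Finset.Icc 2 4) (j l : Fin (k + 1)) :
      |taylorRemainder N (christoffel G i j l) (axisPoint s) u| ≤ K * ‖u‖ ^ (N + 1) :=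
    abs_taylorRemainder_le (fun t ht => (hsmooth t ht i j l).of_le (by exact_mod_cast le_top))
      fun t ht => (norm_iteratedFDeriv_christoffel_le_derivSum hN i j l _).trans (hK t ht)
  have hp (j : Fin (k + 1)) : ‖p j‖ ≤ ‖p‖ := norm_le_pi_norm p j
  set W := ‖u‖ ^ 4 + ‖p‖ ^ 4
  have hcubic := abs_sum_mul_mink_le (ι := Unit) (fun _ => hR 3 (by simp) 0 0)
    (fun _ => le_refl ‖dl‖) fun _ => le_refl ‖dl‖
  have hquadratic := abs_sum_mul_mink_le (fun j => hR 2 (by simp) j 0) hp fun _ => le_refl ‖dl‖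
  have hlinear := abs_sum_mul_mink_le (ι := Fin (k + 1) × Fin (k + 1))
    (fun a => hR 1 (by simp) a.1 a.2) (fun a => hp a.1) fun a => hp a.2
  have h4 : ‖u‖ ^ 4 ≤ W := le_add_of_nonneg_right (by positivity)
  have h3 : ‖u‖ ^ 3 * ‖p‖ ≤ W := by
    simpa using pow_mul_pow_le_pow_add_pow (norm_nonneg u) (norm_nonneg p) 3 1
  have h2 : ‖u‖ ^ 2 * ‖p‖ ^ 2 ≤ W :=
    pow_mul_pow_le_pow_add_pow (norm_nonneg u) (norm_nonneg p) 2 2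
  simp only [Finset.univ_unique, Finset.sum_singleton, Fintype.card_unit, Fintype.card_prod,
    Fintype.card_fin, Fintype.sum_prod_type] at hcubic hquadratic hlinear
  rw [higherOrderPart, abs_neg]
  calc _ ≤ _ := (abs_add_three _ _ _).trans (add_le_add_three hcubic
        ((abs_mul _ _).trans_le (mul_le_mul_of_nonneg_left hquadratic (abs_nonneg 2))) hlinear)
    _ = (d + 1) * K * (‖dl‖ ^ 2 * ‖u‖ ^ 4 + 2 * (k + 1) * ‖dl‖ * (‖u‖ ^ 3 * ‖p‖)
          + (k + 1) ^ 2 * (‖u‖ ^ 2 * ‖p‖ ^ 2)) := by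
      rw [abs_two]
      push_cast
      ring
    _ ≤ (d + 1) * K * (‖dl‖ ^ 2 * W + 2 * (k + 1) * ‖dl‖ * W + (k + 1) ^ 2 * W) := by gcongr
    _ = (d + 1) * (‖dl‖ + (k + 1)) ^ 2 * K * W := by ring

lemma isHigherOrder_of_derivSum_le (hG : IsNormalAlongAxis G r) (dl : Fin (d + 1) → ℝ)
    {C : ℝ → ℝ} {f : V (k + 1) → ℝ} (hf : ContDiffOn ℝ ∞ f (normalTube k r))
    (h : ∀ s, ∀ u ∈ normalTube k r, ∀ t ∈ Set.Icc (0 : ℝ) 1,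
      derivSum G (axisPoint s + t • u) ≤ C s * f u) :
    IsHigherOrder (normalTube k r) C (higherOrderPart G dl) := by
  refine ⟨fun w => (d + 1) * (‖dl‖ + (k + 1)) ^ 2 * f w.1,
    contDiffOn_const.mul (hf.comp contDiff_fst.contDiffOn fun _ hw => hw), fun i z hz => ?_⟩
  refine (abs_higherOrderPart_le dl (fun t ht => hG.contDiffAt_christoffel
    (axisPoint_add_smul_mem_normalTube hz _ ht)) (h z.1 z.2.1 hz) i z.2.2).trans_eq ?_
  ring

end HigherOrder

section CompactExhaustion

variable {X Y P : Type*} [TopologicalSpace X] [TopologicalSpace Y] [TopologicalSpace P]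

lemma exists_eventually_comp_find_le (K : CompactExhaustion X) (b : ℕ → ℝ) (x : X) :
    ∃ c, ∀ᶠ y in 𝓝 x, b (K.find y) ≤ c := by
  obtain ⟨n, hn⟩ := K.exists_mem_nhds x
  obtain ⟨c, hc⟩ := ((Set.finite_Iic n).image b).bddAbove
  exact ⟨c, mem_of_superset hn fun y hy => hc ⟨K.find y, K.mem_iff_find_le.1 hy, rfl⟩⟩

lemma exists_le_mul_comp_find [CompactSpace P] (K : CompactExhaustion X) (L : CompactExhaustion Y)
    {S : X × Y × P → ℝ} (hS : Continuous S) :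
    ∃ b : ℕ → ℝ, ∀ x y p, S (x, y, p) ≤ b (K.find x) * b (L.find y) := by
  have hbound (n : ℕ) : ∃ c, ∀ x ∈ K n, ∀ y ∈ L n, ∀ p, S (x, y, p) ≤ c := by
    obtain ⟨c, hc⟩ :=
      (((K.isCompact n).prod ((L.isCompact n).prod isCompact_univ)).image hS).bddAbove
    exact ⟨c, fun x hx y hy p => hc ⟨(x, y, p), ⟨hx, hy, Set.mem_univ p⟩, rfl⟩⟩
  choose c hc using hbound
  refine ⟨fun n => 1 + |c n|, fun x y p => ?_⟩
  -- The bound over the larger of the two pieces is dominated by the factor with the larger index.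
  have hmax := hc (max (K.find x) (L.find y)) x (K.mem_iff_find_le.2 (le_max_left _ _)) y
    (L.mem_iff_find_le.2 (le_max_right _ _)) p
  rcases max_choice (K.find x) (L.find y) with h | h <;> rw [h] at hmax <;>
    nlinarith [le_abs_self (c (K.find x)), le_abs_self (c (L.find y)), abs_nonneg (c (K.find x)),
      abs_nonneg (c (L.find y))]

end CompactExhaustion

section Majorants

lemma exists_contDiffOn_majorant {E ι : Type*} [NormedAddCommGroup E] [NormedSpace ℝ E]
    [FiniteDimensional ℝ E] {U : TopologicalSpace.Opens E} {B : ι → U → ℝ}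
    (hB : ∀ x, ∃ c, ∀ᶠ y in 𝓝 x, ∀ a, B a y ≤ c) :
    ∃ f : E → ℝ, ContDiffOn ℝ ∞ f U ∧ ∀ a (x : U), B a x ≤ f x := by
  have := U.isOpen.locallyCompactSpace
  obtain ⟨f, hf⟩ := exists_contMDiffMap_forall_mem_convex_of_local_const (n := ⊤) 𝓘(ℝ, E)
    (t := fun x : U => {c : ℝ | ∀ a, B a x ≤ c})
    (fun x _ hc _ hc' _ _ hα hβ h a => convex_Ici (B a x) (hc a) (hc' a) hα hβ h) hB
  have hextend (x : U) : Function.extend Subtype.val f 0 (x : E) = f x :=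
    Subtype.val_injective.extend_apply _ _ x
  refine ⟨Function.extend Subtype.val f 0, fun x hx => ContDiffAt.contDiffWithinAt ?_,
    fun a x => (hf x a).trans_eq (hextend x).symm⟩
  rw [← contMDiffAt_iff_contDiffAt]
  refine contMDiffAt_subtype_iff (x := ⟨x, hx⟩).1 ?_
  simpa only [hextend] using f.contMDiff ⟨x, hx⟩

variable {k : ℕ} {r : ENNReal} {S : V (k + 1) → ℝ}

lemma exists_product_majorant (hS : ContinuousOn S (normalTube k r)) :
    ∃ C : ℝ → ℝ, Continuous C ∧ ∃ f : V (k + 1) → ℝ, ContDiffOn ℝ ∞ f (normalTube k r) ∧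
      ∀ s, ∀ u ∈ normalTube k r, ∀ t ∈ Set.Icc (0 : ℝ) 1, S (axisPoint s + t • u) ≤ C s * f u := by
  let U : TopologicalSpace.Opens (V (k + 1)) := ⟨normalTube k r, isOpen_normalTube r⟩
  have := U.isOpen.locallyCompactSpace
  let K := CompactExhaustion.choice ℝ
  let L := CompactExhaustion.choice U
  have hcont : Continuous fun z : ℝ × U × unitInterval =>
      S (axisPoint z.1 + (z.2.2 : ℝ) • (z.2.1 : V (k + 1))) :=
    hS.comp_continuous (by have := (contDiff_axisPoint (k := k)).continuous; fun_prop)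
      fun z => axisPoint_add_smul_mem_normalTube z.2.1.2 z.1 z.2.2.2
  obtain ⟨b, hb⟩ := exists_le_mul_comp_find K L hcont
  obtain ⟨C, hC⟩ := exists_continuous_forall_mem_convex_of_local_const
    (fun s => convex_Ici |b (K.find s)|) (exists_eventually_comp_find_le K fun n => |b n|)
  obtain ⟨f, hf, hbf⟩ := exists_contDiffOn_majorant (B := fun (_ : Unit) u => |b (L.find u)|)
    fun u => (exists_eventually_comp_find_le L (fun n => |b n|) u).imp
      fun c hc => hc.mono fun _ h _ => h
  refine ⟨C, C.continuous, f, hf, fun s u hu t ht => (hb s ⟨u, hu⟩ ⟨t, ht⟩).trans ?_⟩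
  calc _ ≤ |b (K.find s)| * |b (L.find ⟨u, hu⟩)| := (le_abs_self _).trans_eq (abs_mul _ _)
    _ ≤ C s * f u := mul_le_mul (hC s) (hbf () ⟨u, hu⟩) (abs_nonneg _) ((abs_nonneg _).trans (hC s))

lemma exists_uniform_majorant
    (hS : ∀ ρ : NNReal, (ρ : ENNReal) < r → ∃ K, ∀ x : V (k + 1), ‖normalPart x‖ₑ ≤ ρ → S x ≤ K) :
    ∃ f : V (k + 1) → ℝ, ContDiffOn ℝ ∞ f (normalTube k r) ∧
      ∀ s, ∀ u ∈ normalTube k r, ∀ t ∈ Set.Icc (0 : ℝ) 1, S (axisPoint s + t • u) ≤ f u := by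
  let U : TopologicalSpace.Opens (V (k + 1)) := ⟨normalTube k r, isOpen_normalTube r⟩
  have hlocal (u : U) : ∃ c, ∀ᶠ v : U in 𝓝 u, ∀ a : ℝ × unitInterval,
      S (axisPoint a.1 + (a.2 : ℝ) • (v : V (k + 1))) ≤ c := by
    obtain ⟨ρ, huρ : (u : V (k + 1)) ∈ normalTube k ρ, hρ⟩ :=
      ENNReal.lt_iff_exists_nnreal_btwn.1 u.2
    obtain ⟨c, hc⟩ := hS ρ hρ
    refine ⟨c, ?_⟩
    filter_upwards [continuousAt_subtype_val.eventually_mem ((isOpen_normalTube ρ).mem_nhds huρ)]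
      with v hv a
    exact hc _ (axisPoint_add_smul_mem_normalTube hv a.1 a.2.2).le
  obtain ⟨f, hf, hSf⟩ := exists_contDiffOn_majorant hlocal
  exact ⟨f, hf, fun s u hu t ht => hSf (s, ⟨t, ht⟩) ⟨u, hu⟩⟩

end Majorants

namespace IsNormalAlongAxis

variable {k d : ℕ} {G : V (k + 1) → Matrix (Fin (k + 1)) (Fin (k + 1)) ℝ} {r : ENNReal}
  {ell : V (d + 1) →ₗ[ℝ] ℝ} {dl : Fin (d + 1) → ℝ} {u : V (d + 1) → V (k + 1)} {y : V (d + 1)}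

lemma waveMapOp_perturbedMap_eq_zero_iff (hG : IsNormalAlongAxis G r)
    (hdl : ∀ μ, dl μ = ell (basisVec μ)) (hu : ContDiffAt ℝ 2 u y) (i : Fin (k + 1)) :
    waveMapOp G (perturbedMap ell u) i y = 0 ↔
      box (fun z => u z i) y
        + ∑ m : Fin k, riemann G m.succ 0 0 i (axisPoint (ell y)) * u y m.succ * mink dl dl
        = nonlinearity G dl i (ell y) (u y) (jet u y)
          + higherOrderPart G dl i (ell y, u y, jet u y) := by
  rw [hG.waveMapOp_perturbedMap hdl hu i, sub_sub, sub_eq_zero]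

lemma waveMapOp_perturbedMap_zero_eq_zero_iff (hG : IsNormalAlongAxis G r)
    (hdl : ∀ μ, dl μ = ell (basisVec μ)) (hu : ContDiffAt ℝ 2 u y) :
    waveMapOp G (perturbedMap ell u) 0 y = 0 ↔
      box (fun z => u z 0) y = nonlinearity G dl 0 (ell y) (u y) (jet u y)
        + higherOrderPart G dl 0 (ell y, u y, jet u y) := by
  simp only [hG.waveMapOp_perturbedMap_eq_zero_iff hdl hu, hG.riemann_axis,
    hG.pderiv_christoffel_zero_zero_zero_axis, zero_mul, Finset.sum_const_zero, add_zero]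

lemma exists_isHigherOrder (hG : IsNormalAlongAxis G r) (dl : Fin (d + 1) → ℝ) :
    ∃ C : ℝ → ℝ, Continuous C ∧ IsHigherOrder (normalTube k r) C (higherOrderPart G dl) := by
  obtain ⟨C, hC, f, hf, hbound⟩ := exists_product_majorant (continuousOn_derivSum hG)
  exact ⟨C, hC, isHigherOrder_of_derivSum_le hG dl hf hbound⟩

lemma exists_isHigherOrder_const (hG : IsNormalAlongAxis G r) (dl : Fin (d + 1) → ℝ)
    (hbounded : ∀ ρ : NNReal, (ρ : ENNReal) < r → ∃ K : ℝ, ∀ x : V (k + 1),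
      ‖normalPart x‖ₑ ≤ ρ → ∀ q : ℕ, 2 ≤ q → q ≤ 4 → ∀ (A : Fin q → Fin (k + 1))
      (i j l : Fin (k + 1)), |multiDeriv A (christoffel G i j l) x| ≤ K) :
    ∃ C : ℝ, IsHigherOrder (normalTube k r) (fun _ => C) (higherOrderPart G dl) := by
  obtain ⟨f, hf, hbound⟩ := exists_uniform_majorant fun ρ hρ =>
    let ⟨_, hK⟩ := hbounded ρ hρ
    ⟨_, fun x hx => derivSum_le_of_multiDeriv (hK x hx)⟩
  exact ⟨1, isHigherOrder_of_derivSum_le hG dl hf (by simpa only [one_mul] using hbound)⟩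

end IsNormalAlongAxis

end FermiWaveMap

open FermiWaveMap in
theorem proposition3p2_general {k d : ℕ} {M : Type*} [TopologicalSpace M] [T2Space M]
    [ChartedSpace (V (k + 1)) M] [IsManifold (𝓡 (k + 1)) ∞ M]
    (g : FermiWaveMap.Metric (k + 1) M)
    (γ : ℝ → M) (hγ : IsGeodesic g γ)
    (e : Fin (k + 1) → ∀ t, TangentSpace (𝓡 (k + 1)) (γ t)) (hg : IsNormallyComplete g γ e)
    (he : IsFermiFrame g γ e)
    (ell : V (d + 1) →ₗ[ℝ] ℝ) (dl : Fin (d + 1) → ℝ) (hdl : ∀ μ, dl μ = ell (basisVec μ)) :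
    (∀ s : ℝ, axisPoint s ∈ fermiDomain g γ e → ∀ (q : ℕ) (i j l : Fin (k + 1)),
      multiDeriv (fun _ : Fin q => (0 : Fin (k + 1)))
        (christoffel (fermiMetric g γ e) i j l) (axisPoint s) = 0) ∧
    ∃ h : Fin (k + 1) → ℝ × V (k + 1) × (Fin (k + 1) → Fin (d + 1) → ℝ) → ℝ,
      (∀ i, ContDiffOn ℝ ∞ (h i) (jetDomain d (fermiDomain g γ e))) ∧
      (∃ C : ℝ → ℝ, Continuous C ∧ IsHigherOrder (fermiDomain g γ e) C h) ∧
      ((∀ ρ : NNReal, (ρ : ENNReal) < focalRadius g γ e → ∃ K : ℝ, ∀ x : V (k + 1),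
          ‖normalPart x‖ₑ ≤ ρ → ∀ q : ℕ, 2 ≤ q → q ≤ 4 → ∀ (A : Fin q → Fin (k + 1))
          (i j l : Fin (k + 1)), |multiDeriv A (christoffel (fermiMetric g γ e) i j l) x| ≤ K) →
        ∃ C : ℝ, IsHigherOrder (fermiDomain g γ e) (fun _ => C) h) ∧
      ∀ (u : V (d + 1) → V (k + 1)) (y : V (d + 1)),
        ContDiffAt ℝ 2 u y → u y ∈ fermiDomain g γ e →
        (waveMapOp (fermiMetric g γ e) (perturbedMap ell u) 0 y = 0 ↔
          box (fun z => u z 0) y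
            = nonlinearity (fermiMetric g γ e) dl 0 (ell y) (u y) (jet u y)
              + h 0 (ell y, u y, jet u y)) ∧
        ∀ i : Fin k,
          (waveMapOp (fermiMetric g γ e) (perturbedMap ell u) i.succ y = 0 ↔
            box (fun z => u z i.succ) y
              + ∑ m : Fin k, riemann (fermiMetric g γ e) m.succ 0 0 i.succ (axisPoint (ell y))
                  * u y m.succ * mink dl dl
              = nonlinearity (fermiMetric g γ e) dl i.succ (ell y) (u y) (jet u y)
                + h i.succ (ell y, u y, jet u y)) := by
  rcases eq_zero_or_pos (focalRadius g γ e) with hr | hr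
  · have hempty (x : V (k + 1)) : x ∉ fermiDomain g γ e := by simp [fermiDomain, hr]
    exact ⟨fun s hs => absurd hs (hempty _), fun _ _ => 0, fun _ => contDiffOn_const,
      ⟨0, continuous_const, 0, contDiffOn_const, fun _ _ hz => absurd hz (hempty _)⟩,
      fun _ => ⟨0, 0, contDiffOn_const, fun _ _ hz => absurd hz (hempty _)⟩,
      fun _ _ _ hu => absurd hu (hempty _)⟩
  have hG := isNormalAlongAxis_fermiMetric hg hγ he hr
  exact ⟨fun s _ q i j l => hG.multiDeriv_christoffel_axis q i j l s,
    higherOrderPart (fermiMetric g γ e) dl, contDiffOn_higherOrderPart hG dl,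
    hG.exists_isHigherOrder dl, hG.exists_isHigherOrder_const dl,
    fun u y hu _ => ⟨hG.waveMapOp_perturbedMap_zero_eq_zero_iff hdl hu,
      fun i => hG.waveMapOp_perturbedMap_eq_zero_iff hdl hu i.succ⟩⟩

open FermiWaveMap in
theorem proposition3p2 {k d : ℕ} {M : Type*} [TopologicalSpace M] [T2Space M]
    [ChartedSpace (V (k + 1)) M] [IsManifold (𝓡 (k + 1)) ∞ M]
    (g : FermiWaveMap.Metric (k + 1) M) (hg : FermiWaveMap.IsComplete g)
    (γ : ℝ → M) (hγ : IsGeodesic g γ)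
    (e : Fin (k + 1) → ∀ t, TangentSpace (𝓡 (k + 1)) (γ t)) (he : IsFermiFrame g γ e)
    (ell : V (d + 1) →ₗ[ℝ] ℝ) (dl : Fin (d + 1) → ℝ) (hdl : ∀ μ, dl μ = ell (basisVec μ)) :
    -- all pure `x¹`-derivatives of the Christoffel symbols vanish along the geodesic
    (∀ s : ℝ, axisPoint s ∈ fermiDomain g γ e → ∀ (q : ℕ) (i j l : Fin (k + 1)),
      multiDeriv (fun _ : Fin q => (0 : Fin (k + 1)))
        (christoffel (fermiMetric g γ e) i j l) (axisPoint s) = 0) ∧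
    ∃ h : Fin (k + 1) → ℝ × V (k + 1) × (Fin (k + 1) → Fin (d + 1) → ℝ) → ℝ,
      -- `h` is smooth and of higher order
      (∀ i, ContDiffOn ℝ ∞ (h i) (jetDomain d (fermiDomain g γ e))) ∧
      (∃ C : ℝ → ℝ, Continuous C ∧ IsHigherOrder (fermiDomain g γ e) C h) ∧
      -- with a uniform constant if the Christoffel symbols have uniformly bounded derivatives
      ((∀ ρ : NNReal, (ρ : ENNReal) < focalRadius g γ e → ∃ K : ℝ, ∀ x : V (k + 1),
          ‖normalPart x‖ₑ ≤ ρ → ∀ q : ℕ, 2 ≤ q → q ≤ 4 → ∀ (A : Fin q → Fin (k + 1))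
          (i j l : Fin (k + 1)), |multiDeriv A (christoffel (fermiMetric g γ e) i j l) x| ≤ K) →
        ∃ C : ℝ, IsHigherOrder (fermiDomain g γ e) (fun _ => C) h) ∧
      -- the wave map equations for `φ = (ℓ + u¹, u⃗)` are the wave and Klein-Gordon equations
      ∀ (u : V (d + 1) → V (k + 1)) (y : V (d + 1)),
        ContDiffAt ℝ 2 u y → u y ∈ fermiDomain g γ e →
        (waveMapOp (fermiMetric g γ e) (perturbedMap ell u) 0 y = 0 ↔
          box (fun z => u z 0) y
            = nonlinearity (fermiMetric g γ e) dl 0 (ell y) (u y) (jet u y)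
              + h 0 (ell y, u y, jet u y)) ∧
        ∀ i : Fin k,
          (waveMapOp (fermiMetric g γ e) (perturbedMap ell u) i.succ y = 0 ↔
            box (fun z => u z i.succ) y
              + ∑ m : Fin k, riemann (fermiMetric g γ e) m.succ 0 0 i.succ (axisPoint (ell y))
                  * u y m.succ * mink dl dl
              = nonlinearity (fermiMetric g γ e) dl i.succ (ell y) (u y) (jet u y)
                + h i.succ (ell y, u y, jet u y)) := by
  exact proposition3p2_general g γ hγ e (fun s v => hg _) he ell dl hdl
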